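/- Let $X$ be a complex Banach space and let $-A:\mathsf D(A)\subseteq X\to X$ be the generator of a locally bounded, strongly measurable semigroup $(S(t))_{t\ge 0}\subset\mathscr L(X)$ with $S(0)=\mathrm{id}_X$ (strong continuity at $0$ is not assumed); that is, $x\in \mathsf D(A)$ and $Ax=y$ if and only if $S(t)x=x-\int_0^tS(r)y\,dr$ for all $t\ge0$. Assume that the semigroup is uniformly exponentially stable: there are $M_0\ge1$ and $w>0$ with $\|S(t)\|\le M_0e^{-wt}$ for all $t\ge0$. Let $p\in[1,\infty]$ and $t_0\in\mathbb R$, and let $s\in[1,\infty)$ if $p=1$ and $s\in(1/p,\infty)$ otherwise (with $1/\infty=0$). Write $\{s\}=s-\lfloor s\rfloor$. **Notation.** For $r>0$ put $$\mathfrak I^r u(t)=\frac1{\Gamma(r)}\int_0^\infty\tau^{r-1}S(\tau)u(t-\tau)\,d\tau$$ (Bochner integral) and $\mathfrak I^0u=u$. Since $\mathfrak I^r u(t)$ only involves values of $u$ on $(-\infty,t]$, it is also defined, for $t\le t_0$, for functions on $(-\infty,t_0]$. On $L^p(-\infty,t_0;X)$ let $\partial_t+A$ have domain $W^{1,p}(-\infty,t_0;X)\cap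 L^p(-\infty,t_0;\mathsf D(A))$, where $\partial_t$ is the weak derivative. For $r\ge 0$ let $$\mathfrak D^r=(\partial_t+A)^{\lceil r\rceil}\,\mathfrak I^{\lceil r\rceil-r},$$ with domain $\mathsf D(\mathfrak D^r)$ consisting of all $u\in L^p(-\infty,t_0;X)$ such that $\mathfrak I^{\lceil r\rceil-r}u\in\mathsf D((\partial_t+A)^{\lceil r\rceil})$. A tilde denotes extension by zero from $(-\infty,t_0]$ to $\mathbb R$. **Dirichlet solution.** Let $g:(-\infty,t_0]\to X$ be bounded and continuous with $g\in\mathsf D(\mathfrak D^{\max(s-1,0)})$ such that $\mathfrak D^{\max(s-1,0)}g$ is (a.e. equal to) a bounded continuous function on $(-\infty,t_0]$. The Dirichlet solution of order $s$ with data $g$ is the function $u:\mathbb R\to X$ with $u=g$ on $(-\infty,t_0]$ and, for $t>t_0$, $$u(t)=\frac{\sin(\pi\{s\})}{\pi}\int_0^\infty\frac{\tau^{-\{s\}}}{\tau+1}S((t-t_0)(\tau+1))\,g(t_0-(t-t_0)\tau)\,d\tau+\sum_{k=1}^{\lfloor s\rfloor}\frac{(t-t_0)^{\{s\}+k-1}}{\Gamma(\{s\}+k)}S(t-t_0)\,\mathfrak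 D^{\{s\}+k-1}g(t_0),$$ where $\mathfrak D^{\{s\}+k-1}g(t_0)$ is the value at $t_0$ of the representative that is continuous on $(-\infty,t_0]$. (For integer $s$ the same formula is used; its first term is then zero.) **Theorem.** (i) Let $f\in L^p(-\infty,t_0;X)$. Then $\mathfrak I^sf(r)$ for all $r\le t_0$, $\mathfrak I^{\lfloor s\rfloor-k+1}f(t_0)$ for $1\le k\le\lfloor s\rfloor$, and, for all $t>t_0$, $\mathfrak I^s\widetilde f(t)$ and the integral below converge as Bochner integrals, and for all $t\in(t_0,\infty)$ $$\mathfrak I^s\widetilde f(t)=\frac{\sin(\pi\{s\})}{\pi}\int_0^\infty\frac{\tau^{-\{s\}}}{\tau+1}S((t-t_0)(\tau+1))\,\mathfrak I^sf(t_0-(t-t_0)\tau)\,d\tau+\sum_{k=1}^{\lfloor s\rfloor}\frac{(t-t_0)^{\{s\}+k-1}}{\Gamma(\{s\}+k)}S(t-t_0)\,\mathfrak I^{\lfloor s\rfloor-k+1}f(t_0).$$ (ii) Let $g\in\mathsf D(\mathfrak D^s)$. Then $g$ has a bounded continuous representative on $(-\infty,t_0]$ for which the Dirichlet solution $u$ of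 order $s$ is defined, and $v:=\mathfrak I^s\,\widetilde{\mathfrak D^sg}$ satisfies $v(t)=u(t)$ for all $t\in(t_0,\infty)$. -/

import Mathlib

open MeasureTheory Set

noncomputable section

namespace FracParabolic

variable {X : Type*} [NormedAddCommGroup X] [NormedSpace ℂ X]

/-- A locally bounded, strongly measurable semigroup `(S(t))_{t ≥ 0}` of bounded linear operators
on `X`. The values `S t` for `t < 0` are irrelevant. Strong continuity at `0` is not required. -/
structure IsMeasurableSemigroup (S : ℝ → X →L[ℂ] X) : Prop where
  map_zero : S 0 = ContinuousLinearMap.id ℂ X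
  map_add : ∀ r t : ℝ, 0 ≤ r → 0 ≤ t → S (r + t) = (S r).comp (S t)
  measurable : ∀ x : X, AEStronglyMeasurable (fun t => S t x) (volume.restrict (Ioi (0 : ℝ)))
  locallyBounded : ∀ T : ℝ, ∃ C : ℝ, ∀ t ∈ Icc 0 T, ‖S t‖ ≤ C

/-- `-A` is the generator of `(S(t))_{t ≥ 0}`: `x ∈ D(A)` and `A x = y` hold if and only if
`S(t) x = x - ∫₀ᵗ S(r) y dr` for all `t ≥ 0`. By uniqueness of Laplace transforms this says that
`λ + A` is invertible with inverse `x ↦ ∫₀^∞ e^{-λ t} S(t) x dt` for large `λ`, the definition of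
the generator of a measurable semigroup; for a strongly continuous semigroup it is the same as the
definition through the derivative at `0`. -/
def IsNegGenerator (S : ℝ → X →L[ℂ] X) (A : X →ₗ.[ℂ] X) : Prop :=
  ∀ x y : X, (x, y) ∈ A.graph ↔ ∀ t : ℝ, 0 ≤ t → S t x = x - ∫ r in (0 : ℝ)..t, S r y

/-- Uniform exponential stability. -/
def UniformlyExpStable (S : ℝ → X →L[ℂ] X) : Prop :=
  ∃ M w : ℝ, 1 ≤ M ∧ 0 < w ∧ ∀ t : ℝ, 0 ≤ t → ‖S t‖ ≤ M * Real.exp (-w * t)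

/-- The Riemann--Liouville type fractional parabolic integral of order `s ≥ 0` of `u` at `t`.
It depends only on the values of `u` to the left of `t` (and on `u t` if `s = 0`), so it applies
to functions on `(-∞, t₀]` at every `t ≤ t₀`. -/
def fracInt (S : ℝ → X →L[ℂ] X) (s : ℝ) (u : ℝ → X) (t : ℝ) : X :=
  if s = 0 then u t
  else (1 / Real.Gamma s) • ∫ τ in Ioi (0 : ℝ), τ ^ (s - 1) • S τ (u (t - τ))

/-- The Bochner integral in `fracInt S s u t` converges. -/
def FracIntConvergesAt (S : ℝ → X →L[ℂ] X) (s : ℝ) (u : ℝ → X) (t : ℝ) : Prop :=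
  s = 0 ∨ IntegrableOn (fun τ : ℝ => τ ^ (s - 1) • S τ (u (t - τ))) (Ioi 0)

/-- Lebesgue measure on `(-∞, t₀)`. Elements of `L^p(-∞, t₀; X)` are functions `f : ℝ → X` with
`MemLp f p (leftLine t₀)`, up to equality a.e. for this measure. -/
abbrev leftLine (t₀ : ℝ) : Measure ℝ := volume.restrict (Iio t₀)

/-- `u'` is the weak derivative of `u` on `(-∞, t₀)`. -/
def HasWeakDeriv (t₀ : ℝ) (u u' : ℝ → X) : Prop :=
  ∀ φ : ℝ → ℝ, ContDiff ℝ (⊤ : ℕ∞) φ → HasCompactSupport φ → tsupport φ ⊆ Iio t₀ →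
    ∫ t in Iio t₀, deriv φ t • u t = - ∫ t in Iio t₀, φ t • u' t

/-- `u ∈ W^{1,p}(-∞, t₀; X) ∩ L^p(-∞, t₀; D(A))` and `(∂ₜ + A) u = f`. -/
def HasParabolic (A : X →ₗ.[ℂ] X) (p : ENNReal) (t₀ : ℝ) (u f : ℝ → X) : Prop :=
  MemLp u p (leftLine t₀) ∧
  ∃ u' a : ℝ → X, MemLp u' p (leftLine t₀) ∧ MemLp a p (leftLine t₀) ∧
    HasWeakDeriv t₀ u u' ∧
    (∀ᵐ t ∂(leftLine t₀), (u t, a t) ∈ A.graph) ∧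
    f =ᵐ[leftLine t₀] fun t => u' t + a t

/-- `u` belongs to the domain of the power `(∂ₜ + A)ⁿ` in `L^p(-∞, t₀; X)` and
`(∂ₜ + A)ⁿ u = f`. -/
def HasParabolicPow (A : X →ₗ.[ℂ] X) (p : ENNReal) (t₀ : ℝ) :
    ℕ → (ℝ → X) → (ℝ → X) → Prop
  | 0, u, f => MemLp u p (leftLine t₀) ∧ f =ᵐ[leftLine t₀] u
  | n + 1, u, f => ∃ v : ℝ → X, HasParabolicPow A p t₀ n u v ∧ HasParabolic A p t₀ v f

/-- `g` belongs to the domain in `L^p(-∞, t₀; X)` of the Riemann--Liouville type fractional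
parabolic derivative `𝔇^s` of order `s ≥ 0`, and `𝔇^s g = f` (as elements of `L^p`), where
`𝔇^s g = (∂ₜ + A)^⌈s⌉ 𝔍^(⌈s⌉ - s) g`. -/
def HasFracDeriv (S : ℝ → X →L[ℂ] X) (A : X →ₗ.[ℂ] X) (p : ENNReal) (t₀ s : ℝ)
    (g f : ℝ → X) : Prop :=
  MemLp g p (leftLine t₀) ∧
  (∀ᵐ t ∂(leftLine t₀), FracIntConvergesAt S ((⌈s⌉₊ : ℝ) - s) g t) ∧
  HasParabolicPow A p t₀ ⌈s⌉₊ (fracInt S ((⌈s⌉₊ : ℝ) - s) g) f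

/-- `g` restricts to a bounded continuous function on `(-∞, t₀]`. -/
def IsBddCont (t₀ : ℝ) (g : ℝ → X) : Prop :=
  ContinuousOn g (Iic t₀) ∧ ∃ C : ℝ, ∀ t ≤ t₀, ‖g t‖ ≤ C

/-- `x = 𝔇^s g (t₀)`: the value at `t₀` of the representative of `𝔇^s g` which is continuous on
`(-∞, t₀]`. -/
def HasFracDerivValue (S : ℝ → X →L[ℂ] X) (A : X →ₗ.[ℂ] X) (p : ENNReal) (t₀ s : ℝ)
    (g : ℝ → X) (x : X) : Prop :=
  ∃ d : ℝ → X, HasFracDeriv S A p t₀ s g d ∧ ContinuousOn d (Iic t₀) ∧ d t₀ = x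

/-- The term `sin(π{s})/π ∫₀^∞ τ^{-{s}}/(τ+1) S((t-t₀)(τ+1)) h(t₀-(t-t₀)τ) dτ`. -/
def integralTerm (S : ℝ → X →L[ℂ] X) (t₀ s : ℝ) (h : ℝ → X) (t : ℝ) : X :=
  (Real.sin (Real.pi * Int.fract s) / Real.pi) •
    ∫ τ in Ioi (0 : ℝ), (τ ^ (-Int.fract s) / (τ + 1)) •
      S ((t - t₀) * (τ + 1)) (h (t₀ - (t - t₀) * τ))

/-- The term `∑_{k=1}^{⌊s⌋} (t-t₀)^{{s}+k-1}/Γ({s}+k) S(t-t₀) x_k`. -/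
def sumTerm (S : ℝ → X →L[ℂ] X) (t₀ s : ℝ) (x : ℕ → X) (t : ℝ) : X :=
  ∑ k ∈ Finset.Icc 1 ⌊s⌋₊,
    ((t - t₀) ^ (Int.fract s + k - 1) / Real.Gamma (Int.fract s + k)) • S (t - t₀) (x k)

/-- `g` is admissible as data, and `u` is the solution of the Dirichlet problem of order `s`:
`𝔇^s u = 0` on `(t₀, ∞)`, `u = g` on `(-∞, t₀]`, as given by the solution formula. -/
structure IsDirichletSolution (S : ℝ → X →L[ℂ] X) (A : X →ₗ.[ℂ] X) (p : ENNReal) (t₀ s : ℝ)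
    (g u : ℝ → X) : Prop where
  bddCont : IsBddCont t₀ g
  deriv_bddCont : ∃ d : ℝ → X, HasFracDeriv S A p t₀ (max (s - 1) 0) g d ∧ IsBddCont t₀ d
  eq_left : ∀ t ≤ t₀, u t = g t
  eq_right : ∃ x : ℕ → X,
    (∀ k ∈ Finset.Icc 1 ⌊s⌋₊, HasFracDerivValue S A p t₀ (Int.fract s + k - 1) g (x k)) ∧
    ∀ t : ℝ, t₀ < t → u t = integralTerm S t₀ s g t + sumTerm S t₀ s x t

end FracParabolic

end

open FracParabolic

noncomputable section

namespace FracParabolic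

open Filter Topology

/-! ### Strong measurability and strong continuity -/

section

variable {X : Type*} [NormedAddCommGroup X] [NormedSpace ℂ X]

/-! Write `a` for the fractional part of `s`, `T = t - t₀`, and let `F` be the extension of `f` by
zero. By Fubini and the semigroup law, every term of the formula in (i) is an integral over `ρ > 0`
of a scalar kernel times the same vector `S (T + ρ) (F (t₀ - ρ))` (`integral_smul_apply_integral`,
`fracInt_right_eq`). The identity thus reduces to one between scalar kernels. After scaling by `T`
this is the Taylor expansion of `(1 + x) ^ (s - 1)` to order `⌊s⌋`, with the integral term as
remainder (`one_add_rpow_eq`): a Beta integral when `0 < s < 1`, then induction on the integer part.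
The restriction on `s` places the kernel in the dual Lebesgue space (`memLp_gammaKernel`), so that
fractional integrals are bounded and continuous (`exists_norm_fracInt_le`, `continuous_fracInt`).

For (ii), let `f = 𝔇^s g`. Two facts reduce the claim to (i): `g = 𝔍^s f`
(`HasFracDeriv.ae_eq_fracInt`), and `𝔇^(s-j) g = 𝔍^j f` for natural `j ≤ s`
(`HasFracDeriv.sub_natCast`). Both rest on `𝔍^1` being a left inverse of `∂ₜ + A`
(`HasParabolic.ae_eq_fracInt`), which is variation of constants tested against smooth functions, and
on injectivity of `𝔍^1` (`ae_eq_zero_of_forall_integral_eq_zero`). Without strong continuity at `0`,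
three substitutes are used: measurable orbits are continuous on `(0, ∞)`, orbits starting in `D(A)`
are continuous at `0`, and a vector killed by all `S r`, `r > 0`, is zero because `A` is
single-valued. -/

theorem aestronglyMeasurable_clm_apply {α : Type*} {m : MeasurableSpace α} {μ : Measure α}
    {T : α → X →L[ℂ] X} (hT : ∀ x, AEStronglyMeasurable (fun a => T a x) μ) {u : α → X}
    (hu : AEStronglyMeasurable u μ) : AEStronglyMeasurable (fun a => T a (u a)) μ := by
  -- Only the orbits of `T` are measurable, not `T` in operator norm, so the claim is built up from
  -- simple functions; pointwise limits pass through each `T a`.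
  have key : ∀ v : α → X, StronglyMeasurable v → AEStronglyMeasurable (fun a => T a (v a)) μ := by
    intro v hv
    induction v, hv using StronglyMeasurable.induction with
    | ind c hs =>
      rename_i s
      refine ((hT c).indicator hs).congr (Eventually.of_forall fun a => ?_)
      by_cases h : a ∈ s <;> simp [h]
    | add hf hg hfg hd h1 h2 =>
      refine (h1.add h2).congr (Eventually.of_forall fun a => ?_)
      simp
    | lim hf hg h1 h2 =>
      exact aestronglyMeasurable_of_tendsto_ae atTop h1
        (Eventually.of_forall fun a => ((T a).continuous.tendsto _).comp (h2 a))
  obtain ⟨v, hv, huv⟩ := hu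
  refine (key v hv).congr ?_
  filter_upwards [huv] with a h
  rw [h]

theorem IsMeasurableSemigroup.aestronglyMeasurable_apply {S : ℝ → X →L[ℂ] X}
    (hS : IsMeasurableSemigroup S) {u : ℝ → X}
    (hu : AEStronglyMeasurable u (volume.restrict (Ioi (0 : ℝ)))) :
    AEStronglyMeasurable (fun τ => S τ (u τ)) (volume.restrict (Ioi (0 : ℝ))) :=
  aestronglyMeasurable_clm_apply hS.measurable hu

theorem IsMeasurableSemigroup.aestronglyMeasurable_apply_add {S : ℝ → X →L[ℂ] X}
    (hS : IsMeasurableSemigroup S) {T : ℝ} (hT : 0 ≤ T) {u : ℝ → X}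
    (hu : AEStronglyMeasurable u (volume.restrict (Ioi (0 : ℝ)))) :
    AEStronglyMeasurable (fun τ => S (T + τ) (u τ)) (volume.restrict (Ioi (0 : ℝ))) := by
  refine ((S T).continuous.comp_aestronglyMeasurable (hS.aestronglyMeasurable_apply hu)).congr ?_
  filter_upwards [ae_restrict_mem measurableSet_Ioi] with τ hτ
  rw [hS.map_add T τ hT (le_of_lt hτ)]
  rfl

/-- Read off from the continuity of the translation action of `DomAddAct` on `Lp`. -/
theorem tendsto_integral_norm_translate_sub {E : Type*} [NormedAddCommGroup E]
    {F : ℝ → E} (hF : Integrable F) :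
    Tendsto (fun c : ℝ => ∫ r, ‖F (c + r) - F r‖) (𝓝 0) (𝓝 0) := by
  have h1 : MemLp F 1 volume := memLp_one_iff_integrable.2 hF
  let f : Lp E 1 (volume : Measure ℝ) := h1.toLp F
  have : Fact ((1 : ENNReal) ≠ ⊤) := ⟨ENNReal.one_ne_top⟩
  have hc : Continuous fun c : ℝ => ‖(DomAddAct.mk c +ᵥ f) - f‖ := by
    have : Continuous fun c : ℝ => DomAddAct.mk c := DomAddAct.continuous_mk
    fun_prop
  have h2 := hc.tendsto 0
  have h0 : (DomAddAct.mk (0 : ℝ)) +ᵥ f = f := by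
    rw [DomAddAct.mk_zero, zero_vadd]
  simp only [h0, sub_self, norm_zero] at h2
  refine h2.congr fun c => ?_
  rw [L1.norm_eq_integral_norm]
  refine integral_congr_ae ?_
  have h3 := DomAddAct.mk_vadd_toLp c h1
  have hf : DomAddAct.mk c +ᵥ f = _ := h3
  have hq : f = h1.toLp F := rfl
  rw [hf, hq]
  have h4 : MemLp (fun x => F (c +ᵥ x)) 1 volume :=
    h1.comp_measurePreserving (measurePreserving_vadd c volume)
  filter_upwards [Lp.coeFn_sub (h4.toLp _) (h1.toLp F), h1.coeFn_toLp, h4.coeFn_toLp]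
    with r e1 e2 e3
  rw [e1, Pi.sub_apply, e2, e3]
  rfl

/-- The difference of `S t x` and `S a x` is `S (a - r)` applied to the difference of the orbit at
`(t - a) + r` and at `r`. Averaging over `r ∈ (a/2, a)` bounds it by the `L¹` modulus of continuity
of the orbit. -/
theorem IsMeasurableSemigroup.continuousOn_apply {S : ℝ → X →L[ℂ] X}
    (hS : IsMeasurableSemigroup S) (x : X) : ContinuousOn (fun t => S t x) (Ioi (0 : ℝ)) := by
  intro a ha
  have ha' : (0 : ℝ) < a := ha
  refine ContinuousAt.continuousWithinAt ?_
  obtain ⟨C, hC⟩ := hS.locallyBounded (2 * a)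
  have hC0 : 0 ≤ C := (norm_nonneg _).trans (hC 0 ⟨le_rfl, by positivity⟩)
  -- The window makes the orbit integrable on the line and contains both `r` and `(t - a) + r`
  -- whenever `r ∈ (a/2, a)` and `t ∈ (a/2, 2a)`.
  let F : ℝ → X := (Ioo 0 (2 * a)).indicator fun t => S t x
  have hF : Integrable F := by
    rw [integrable_indicator_iff measurableSet_Ioo]
    refine Integrable.mono' (integrableOn_const (C := C * ‖x‖) measure_Ioo_lt_top.ne) ?_ ?_
    · exact (hS.measurable x).mono_set Ioo_subset_Ioi_self
    · filter_upwards [ae_restrict_mem measurableSet_Ioo] with t ht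
      exact (S t).le_of_opNorm_le (hC t ⟨ht.1.le, ht.2.le⟩) x
  have hb : ∀ t ∈ Ioo (a / 2) (2 * a),
      ‖S t x - S a x‖ ≤ (2 / a) * C * ∫ r, ‖F ((t - a) + r) - F r‖ := by
    intro t ht
    have hint : Integrable fun r => ‖F ((t - a) + r) - F r‖ :=
      ((hF.comp_add_left (t - a)).sub hF).norm
    have h1 : ∀ r ∈ Ioo (a / 2) a, ‖S t x - S a x‖ ≤ C * ‖F ((t - a) + r) - F r‖ := by
      intro r hr
      have e1 : S t x = S (a - r) (F ((t - a) + r)) := by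
        have hm : (t - a) + r ∈ Ioo 0 (2 * a) := ⟨by linarith [ht.1, hr.1], by linarith [ht.2, hr.2]⟩
        simp only [F, indicator_of_mem hm]
        rw [← ContinuousLinearMap.comp_apply,
          ← hS.map_add _ _ (by linarith [hr.2]) (by linarith [hm.1])]
        congr 2
        ring
      have e2 : S a x = S (a - r) (F r) := by
        have hm : r ∈ Ioo 0 (2 * a) := ⟨by linarith [hr.1], by linarith [hr.2]⟩
        simp only [F, indicator_of_mem hm]
        rw [← ContinuousLinearMap.comp_apply,
          ← hS.map_add _ _ (by linarith [hr.2]) (by linarith [hm.1])]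
        congr 2
        ring
      rw [e1, e2, ← map_sub]
      exact (S (a - r)).le_of_opNorm_le (hC _ ⟨by linarith [hr.2], by linarith [hr.1]⟩) _
    have h2 : ∫ r in Ioo (a / 2) a, ‖S t x - S a x‖ ≤
        ∫ r in Ioo (a / 2) a, C * ‖F ((t - a) + r) - F r‖ :=
      setIntegral_mono_on (integrableOn_const (by simp)) (hint.const_mul C).integrableOn
        measurableSet_Ioo h1
    have h3 : ∫ r in Ioo (a / 2) a, C * ‖F ((t - a) + r) - F r‖ ≤
        ∫ r, C * ‖F ((t - a) + r) - F r‖ :=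
      setIntegral_le_integral (hint.const_mul C) (Eventually.of_forall fun r => by positivity)
    have h4 := h2.trans h3
    rw [integral_const_mul] at h4
    rw [setIntegral_const, Real.volume_real_Ioo_of_le (by linarith), smul_eq_mul] at h4
    calc ‖S t x - S a x‖ = (2 / a) * ((a - a / 2) * ‖S t x - S a x‖) := by field_simp; ring
      _ ≤ (2 / a) * (C * ∫ r, ‖F ((t - a) + r) - F r‖) := by gcongr
      _ = _ := by ring
  have hlim : Tendsto (fun t => (2 / a) * C * ∫ r, ‖F ((t - a) + r) - F r‖) (𝓝 a) (𝓝 0) := by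
    have h1 : Tendsto (fun t : ℝ => t - a) (𝓝 a) (𝓝 0) := by
      simpa using (continuous_sub_right a).tendsto a
    simpa using ((tendsto_integral_norm_translate_sub hF).comp h1).const_mul ((2 / a) * C)
  rw [ContinuousAt, tendsto_iff_norm_sub_tendsto_zero]
  refine squeeze_zero' (Eventually.of_forall fun _ => norm_nonneg _) ?_ hlim
  filter_upwards [Ioo_mem_nhds (show a / 2 < a by linarith) (show a < 2 * a by linarith)] with t ht
  exact hb t ht

end

/-! ### Kernel bounds -/

section

variable {E : Type*} [NormedAddCommGroup E]

/-- Hölder's inequality; the constant is uniform in `T` because measure-preserving maps leave the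
norm of `F` unchanged. -/
theorem exists_integral_mul_norm_comp_le {p q : ENNReal} [p.HolderConjugate q] {F : ℝ → E}
    (hF : MemLp F p volume) {s : Set ℝ} {k : ℝ → ℝ} (hk : MemLp k q (volume.restrict s)) :
    ∃ C : ℝ, ∀ T : ℝ → ℝ, MeasurePreserving T volume volume →
      IntegrableOn (fun x => k x * ‖F (T x)‖) s ∧ ∫ x in s, k x * ‖F (T x)‖ ≤ C := by
  refine ⟨(eLpNorm k q (volume.restrict s) * eLpNorm F p volume).toReal, fun T hT => ?_⟩
  have hFT : MemLp (fun x => ‖F (T x)‖) p (volume.restrict s) :=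
    ((hF.comp_measurePreserving hT).restrict s).norm
  have h1 : Integrable (fun x => k x * ‖F (T x)‖) (volume.restrict s) := hk.integrable_mul hFT
  refine ⟨h1, ?_⟩
  have h2 : eLpNorm (fun x => k x * ‖F (T x)‖) 1 (volume.restrict s) ≤
      eLpNorm k q (volume.restrict s) * eLpNorm F p volume := by
    refine (eLpNorm_smul_le_mul_eLpNorm (p := q) (q := p) hFT.1 hk.1).trans ?_
    gcongr
    rw [eLpNorm_norm, ← eLpNorm_comp_measurePreserving hF.1 hT]
    exact eLpNorm_mono_measure _ Measure.restrict_le_self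
  calc ∫ x in s, k x * ‖F (T x)‖ ≤ ∫ x in s, ‖k x * ‖F (T x)‖‖ :=
        integral_mono h1 h1.norm fun x => le_abs_self _
    _ = (eLpNorm (fun x => k x * ‖F (T x)‖) 1 (volume.restrict s)).toReal := by
        rw [eLpNorm_one_eq_lintegral_enorm, integral_norm_eq_lintegral_enorm h1.1]
    _ ≤ _ := ENNReal.toReal_mono (ENNReal.mul_ne_top hk.2.ne hF.2.ne) h2

theorem exists_rpow_le_mul_exp {r w : ℝ} (hr : 0 ≤ r) (hw : 0 < w) :
    ∃ C : ℝ, 0 < C ∧ ∀ τ : ℝ, 0 ≤ τ → τ ^ r ≤ C * Real.exp (w * τ) := by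
  obtain ⟨n, hn⟩ := exists_nat_ge r
  refine ⟨n.factorial / w ^ n * Real.exp w, by positivity, fun τ hτ => ?_⟩
  -- With a base at least `1` the exponent can be rounded up to an integer.
  calc τ ^ r ≤ (1 + τ) ^ r := Real.rpow_le_rpow hτ (by linarith) hr
    _ ≤ (1 + τ) ^ (n : ℝ) := Real.rpow_le_rpow_of_exponent_le (by linarith) hn
    _ = n.factorial / w ^ n * ((w * (1 + τ)) ^ n / n.factorial) := by
        rw [Real.rpow_natCast, mul_pow]
        field_simp
    _ ≤ n.factorial / w ^ n * Real.exp (w * (1 + τ)) := by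
        gcongr
        exact Real.pow_div_factorial_le_exp _ (by positivity) n
    _ = _ := by
        rw [mul_assoc, ← Real.exp_add]
        ring_nf

/-- The kernel `τ ^ (s - 1) * e ^ (-w τ)`, which dominates the kernel of the fractional integral
of order `s` of an exponentially stable semigroup. -/
def gammaKernel (w s τ : ℝ) : ℝ := τ ^ (s - 1) * Real.exp (-w * τ)

theorem gammaKernel_nonneg {w s τ : ℝ} (hτ : 0 ≤ τ) : 0 ≤ gammaKernel w s τ := by
  unfold gammaKernel
  positivity

theorem measurable_gammaKernel (w s : ℝ) : Measurable (gammaKernel w s) := by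
  unfold gammaKernel
  fun_prop

/-- This is where the condition on `s` comes from. With `q` the dual exponent, the singularity at
`0` is `q`-integrable when `(s - 1) q > -1`, that is `s > 1/p`; for `p = 1` the kernel must be
bounded, which allows `s = 1`. -/
theorem memLp_gammaKernel {p : ENNReal} (hp : 1 ≤ p) {s w : ℝ} (hw : 0 < w)
    (hs : (p = 1 ∧ 1 ≤ s) ∨ (p ≠ 1 ∧ p⁻¹.toReal < s)) :
    MemLp (gammaKernel w s) (1 - p⁻¹)⁻¹ (volume.restrict (Ioi 0)) := by
  rcases hs with ⟨rfl, hs⟩ | ⟨hp1, hs⟩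
  · simp only [inv_one, tsub_self, ENNReal.inv_zero]
    obtain ⟨C, hC, h⟩ := exists_rpow_le_mul_exp (r := s - 1) (by linarith) hw
    refine memLp_top_of_bound (measurable_gammaKernel w s).aestronglyMeasurable C ?_
    filter_upwards [ae_restrict_mem measurableSet_Ioi] with τ hτ
    rw [Real.norm_of_nonneg (gammaKernel_nonneg (le_of_lt hτ))]
    calc gammaKernel w s τ ≤ C * Real.exp (w * τ) * Real.exp (-w * τ) := by
          unfold gammaKernel
          gcongr
          exact h τ (le_of_lt hτ)
      _ = C := by rw [mul_assoc, ← Real.exp_add]; simp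
  · have hlt : p⁻¹ < 1 := by
      rw [ENNReal.inv_lt_one]
      exact lt_of_le_of_ne hp (Ne.symm hp1)
    have hlt' : p⁻¹.toReal < 1 := by
      rw [← ENNReal.toReal_one]
      exact (ENNReal.toReal_lt_toReal hlt.ne_top ENNReal.one_ne_top).2 hlt
    have hq : ((1 - p⁻¹)⁻¹).toReal = (1 - p⁻¹.toReal)⁻¹ := by
      rw [ENNReal.toReal_inv, ENNReal.toReal_sub_of_le hlt.le ENNReal.one_ne_top,
        ENNReal.toReal_one]
    have hpos : 0 < 1 - p⁻¹.toReal := by linarith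
    rw [← integrable_norm_rpow_iff (measurable_gammaKernel w s).aestronglyMeasurable, hq]
    · have h1 := integrableOn_rpow_mul_exp_neg_mul_rpow (p := 1)
        (s := (s - 1) * (1 - p⁻¹.toReal)⁻¹) (b := w * (1 - p⁻¹.toReal)⁻¹) ?_ one_pos
        (by positivity)
      · refine h1.congr_fun (fun τ hτ => ?_) measurableSet_Ioi
        have hτ' : (0 : ℝ) < τ := hτ
        rw [Real.norm_of_nonneg (gammaKernel_nonneg hτ'.le)]
        simp only [gammaKernel, Real.rpow_one]
        rw [Real.mul_rpow (by positivity) (by positivity), ← Real.rpow_mul hτ'.le,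
          ← Real.exp_mul]
        ring_nf
      · rw [← div_eq_mul_inv, lt_div_iff₀ hpos]
        linarith
    · simp
    · simp only [ne_eq, ENNReal.inv_eq_top, tsub_eq_zero_iff_le, not_le]
      exact hlt

theorem exists_gammaKernel_bound {p : ENNReal} (hp : 1 ≤ p) {s w : ℝ} (hw : 0 < w)
    (hs : (p = 1 ∧ 1 ≤ s) ∨ (p ≠ 1 ∧ p⁻¹.toReal < s)) {F : ℝ → E} (hF : MemLp F p volume) :
    ∃ C : ℝ, ∀ t : ℝ, IntegrableOn (fun τ => gammaKernel w s τ * ‖F (t - τ)‖) (Ioi 0) ∧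
      ∫ τ in Ioi 0, gammaKernel w s τ * ‖F (t - τ)‖ ≤ C := by
  have : p.HolderConjugate (1 - p⁻¹)⁻¹ := ENNReal.HolderConjugate.inv_one_sub_inv' hp
  obtain ⟨C, hC⟩ := exists_integral_mul_norm_comp_le hF (memLp_gammaKernel hp hw hs)
  exact ⟨C, fun t => hC (fun τ => t - τ) (Measure.measurePreserving_sub_left volume t)⟩

theorem order_pos {p : ENNReal} {s : ℝ} (hs : (p = 1 ∧ 1 ≤ s) ∨ (p ≠ 1 ∧ p⁻¹.toReal < s)) :
    0 < s := by
  rcases hs with ⟨-, h⟩ | ⟨-, h⟩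
  · linarith
  · exact ENNReal.toReal_nonneg.trans_lt h

theorem order_of_one_le {p : ENNReal} (hp : 1 ≤ p) {s : ℝ} (hs : 1 ≤ s) :
    (p = 1 ∧ 1 ≤ s) ∨ (p ≠ 1 ∧ p⁻¹.toReal < s) := by
  by_cases h : p = 1
  · exact Or.inl ⟨h, hs⟩
  · refine Or.inr ⟨h, lt_of_lt_of_le ?_ hs⟩
    have hlt : p⁻¹ < 1 := by
      rw [ENNReal.inv_lt_one]
      exact lt_of_le_of_ne hp (Ne.symm h)
    rw [← ENNReal.toReal_one]
    exact (ENNReal.toReal_lt_toReal hlt.ne_top ENNReal.one_ne_top).2 hlt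

end

/-! ### Fractional integrals on the line -/

section

variable {X : Type*} [NormedAddCommGroup X] [NormedSpace ℂ X]

theorem aestronglyMeasurable_comp_sub_left {E : Type*} [TopologicalSpace E] {F : ℝ → E}
    (hF : AEStronglyMeasurable F volume) (t : ℝ) :
    AEStronglyMeasurable (fun τ => F (t - τ)) volume :=
  hF.comp_measurePreserving (Measure.measurePreserving_sub_left volume t)

theorem nonneg_of_stable {S : ℝ → X →L[ℂ] X} {M w : ℝ}
    (hM : ∀ t : ℝ, 0 ≤ t → ‖S t‖ ≤ M * Real.exp (-w * t)) : 0 ≤ M := by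
  simpa using (norm_nonneg _).trans (hM 0 le_rfl)

theorem norm_smul_apply_le {S : ℝ → X →L[ℂ] X} {M w : ℝ}
    (hM : ∀ t : ℝ, 0 ≤ t → ‖S t‖ ≤ M * Real.exp (-w * t)) {τ : ℝ} (hτ : 0 ≤ τ) (c : ℝ) (x : X) :
    ‖c • S τ x‖ ≤ M * (|c| * Real.exp (-w * τ) * ‖x‖) := by
  rw [norm_smul, Real.norm_eq_abs]
  calc |c| * ‖S τ x‖ ≤ |c| * (M * Real.exp (-w * τ) * ‖x‖) := by
        gcongr
        exact (S τ).le_of_opNorm_le (hM τ hτ) x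
    _ = _ := by ring

theorem integrableOn_smul_apply {S : ℝ → X →L[ℂ] X} (hS : IsMeasurableSemigroup S) {M w : ℝ}
    (hM : ∀ t : ℝ, 0 ≤ t → ‖S t‖ ≤ M * Real.exp (-w * t)) {φ : ℝ → ℝ} (hφ : Measurable φ)
    {G : ℝ → X} (hG : AEStronglyMeasurable G (volume.restrict (Ioi 0)))
    (h : IntegrableOn (fun τ => |φ τ| * Real.exp (-w * τ) * ‖G τ‖) (Ioi 0)) :
    IntegrableOn (fun τ => φ τ • S τ (G τ)) (Ioi 0) := by
  refine (h.const_mul M).mono' (hφ.aestronglyMeasurable.smul (hS.aestronglyMeasurable_apply hG)) ?_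
  filter_upwards [ae_restrict_mem measurableSet_Ioi] with τ hτ
  exact norm_smul_apply_le hM (le_of_lt hτ) _ _

theorem norm_integral_smul_apply_le {S : ℝ → X →L[ℂ] X} {M w : ℝ}
    (hM : ∀ t : ℝ, 0 ≤ t → ‖S t‖ ≤ M * Real.exp (-w * t)) {φ : ℝ → ℝ} {G : ℝ → X}
    (h : IntegrableOn (fun τ => |φ τ| * Real.exp (-w * τ) * ‖G τ‖) (Ioi 0)) :
    ‖∫ τ in Ioi 0, φ τ • S τ (G τ)‖ ≤
      M * ∫ τ in Ioi 0, |φ τ| * Real.exp (-w * τ) * ‖G τ‖ := by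
  rw [← integral_const_mul]
  refine norm_integral_le_of_norm_le (h.const_mul M) ?_
  filter_upwards [ae_restrict_mem measurableSet_Ioi] with τ hτ
  exact norm_smul_apply_le hM (le_of_lt hτ) _ _

theorem gammaKernel_integrableOn_iff {E : Type*} [NormedAddCommGroup E] {w s : ℝ} {G : ℝ → E} :
    IntegrableOn (fun τ => |τ ^ (s - 1)| * Real.exp (-w * τ) * ‖G τ‖) (Ioi 0) ↔
      IntegrableOn (fun τ => gammaKernel w s τ * ‖G τ‖) (Ioi 0) := by
  refine integrableOn_congr_fun (fun τ hτ => ?_) measurableSet_Ioi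
  have hτ' : (0 : ℝ) < τ := hτ
  simp only [gammaKernel]
  rw [abs_of_nonneg (by positivity)]

theorem fracIntConvergesAt_of_integrableOn {S : ℝ → X →L[ℂ] X} (hS : IsMeasurableSemigroup S)
    {M w : ℝ} (hM : ∀ t : ℝ, 0 ≤ t → ‖S t‖ ≤ M * Real.exp (-w * t)) {F : ℝ → X}
    (hF : AEStronglyMeasurable F volume) {s t : ℝ}
    (h : IntegrableOn (fun τ => gammaKernel w s τ * ‖F (t - τ)‖) (Ioi 0)) :
    FracIntConvergesAt S s F t :=
  Or.inr (integrableOn_smul_apply hS hM (by fun_prop)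
    (aestronglyMeasurable_comp_sub_left hF t).restrict (gammaKernel_integrableOn_iff.2 h))

theorem exists_norm_fracInt_le {S : ℝ → X →L[ℂ] X}
    {M w : ℝ} (hM : ∀ t : ℝ, 0 ≤ t → ‖S t‖ ≤ M * Real.exp (-w * t)) (hw : 0 < w)
    {p : ENNReal} (hp : 1 ≤ p) {s : ℝ}
    (hs : (p = 1 ∧ 1 ≤ s) ∨ (p ≠ 1 ∧ p⁻¹.toReal < s)) {F : ℝ → X} (hF : MemLp F p volume) :
    ∃ C : ℝ, ∀ t, ‖fracInt S s F t‖ ≤ C := by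
  obtain ⟨C, hC⟩ := exists_gammaKernel_bound hp hw hs hF
  refine ⟨|1 / Real.Gamma s| * (M * C), fun t => ?_⟩
  rw [fracInt, if_neg (order_pos hs).ne', norm_smul, Real.norm_eq_abs]
  gcongr
  have h1 := norm_integral_smul_apply_le hM (gammaKernel_integrableOn_iff.2 (hC t).1)
  have h2 : ∫ τ in Ioi 0, |τ ^ (s - 1)| * Real.exp (-w * τ) * ‖F (t - τ)‖ =
      ∫ τ in Ioi 0, gammaKernel w s τ * ‖F (t - τ)‖ := by
    refine setIntegral_congr_fun measurableSet_Ioi fun τ hτ => ?_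
    have hτ' : (0 : ℝ) < τ := hτ
    simp only [gammaKernel]
    rw [abs_of_nonneg (by positivity)]
  rw [h2] at h1
  exact h1.trans (mul_le_mul_of_nonneg_left (hC t).2 (nonneg_of_stable hM))

/-- With `σ = t - τ` as variable, `t` enters only through `φ` and `S`, both continuous away from `σ
= t`, so dominated convergence needs no continuity of `F`. Growth of `φ` at rate `w / 2` leaves
decay at rate `w / 2`. -/
theorem continuous_integral_smul_apply {S : ℝ → X →L[ℂ] X} (hS : IsMeasurableSemigroup S)
    {M w : ℝ} (hM : ∀ t : ℝ, 0 ≤ t → ‖S t‖ ≤ M * Real.exp (-w * t)) (hw : 0 < w)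
    {φ : ℝ → ℝ} (hφm : Measurable φ) (hφc : ContinuousOn φ (Ioi 0)) {C : ℝ} (hC : 0 ≤ C)
    (hφ : ∀ τ : ℝ, 0 < τ → |φ τ| ≤ C * Real.exp (w / 2 * τ))
    {p : ENNReal} (hp : 1 ≤ p) {F : ℝ → X} (hF : MemLp F p volume) :
    Continuous fun t => ∫ τ in Ioi 0, φ τ • S τ (F (t - τ)) := by
  have hM0 := nonneg_of_stable hM
  have hrw : (fun t => ∫ τ in Ioi 0, φ τ • S τ (F (t - τ))) = fun t => ∫ σ,
      (Ioi 0).indicator (fun τ => φ τ • S τ (F σ)) (t - σ) := by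
    funext t
    rw [← integral_indicator measurableSet_Ioi, ← integral_sub_left_eq_self _ volume t]
    refine integral_congr_ae (Eventually.of_forall fun σ => ?_)
    by_cases h : t - σ ∈ Ioi (0 : ℝ)
    · simp only [indicator_of_mem h, sub_sub_cancel]
    · simp only [indicator_of_notMem h]
  rw [hrw, continuous_iff_continuousAt]
  intro a
  obtain ⟨K, hK⟩ := exists_gammaKernel_bound hp (half_pos hw) (order_of_one_le hp le_rfl) hF
  -- One majorant for all `t` within `1` of `a`: the half-line is enlarged to `σ < a + 1`, and `t >
  -- a - 1` costs at most a factor `exp w` in the exponential.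
  have hint : Integrable fun σ => C * M * Real.exp w *
      (Ioi 0).indicator (fun τ => gammaKernel (w / 2) 1 τ * ‖F σ‖) (a + 1 - σ) := by
    refine Integrable.const_mul ?_ _
    have h1 := ((integrable_indicator_iff measurableSet_Ioi).2 (hK (a + 1)).1).comp_sub_left (a + 1)
    refine h1.congr (Eventually.of_forall fun σ => ?_)
    by_cases h : a + 1 - σ ∈ Ioi (0 : ℝ)
    · simp only [indicator_of_mem h, sub_sub_cancel]
    · simp only [indicator_of_notMem h]
  refine continuousAt_of_dominated (Eventually.of_forall fun t => ?_) ?_ hint ?_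
  · have h1 : AEStronglyMeasurable ((Ioi 0).indicator fun τ => φ τ • S τ (F (t - τ))) volume := by
      rw [aestronglyMeasurable_indicator_iff measurableSet_Ioi]
      exact hφm.aestronglyMeasurable.smul (hS.aestronglyMeasurable_apply
        (aestronglyMeasurable_comp_sub_left hF.1 t).restrict)
    refine (aestronglyMeasurable_comp_sub_left h1 t).congr (Eventually.of_forall fun σ => ?_)
    by_cases h : t - σ ∈ Ioi (0 : ℝ)
    · simp only [indicator_of_mem h, sub_sub_cancel]
    · simp only [indicator_of_notMem h]
  · filter_upwards [Ioo_mem_nhds (sub_one_lt a) (lt_add_one a)] with t ht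
    refine Eventually.of_forall fun σ => ?_
    by_cases h : t - σ ∈ Ioi (0 : ℝ)
    · have h' : (0 : ℝ) < t - σ := h
      have h2 : a + 1 - σ ∈ Ioi (0 : ℝ) := by
        rw [mem_Ioi]
        linarith [ht.2]
      simp only [indicator_of_mem h, indicator_of_mem h2, gammaKernel, sub_self, Real.rpow_zero,
        one_mul]
      calc _ ≤ M * (|φ (t - σ)| * Real.exp (-w * (t - σ)) * ‖F σ‖) :=
            norm_smul_apply_le hM h'.le _ _
        _ ≤ M * (C * Real.exp (w / 2 * (t - σ)) * Real.exp (-w * (t - σ)) * ‖F σ‖) := by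
            gcongr
            exact hφ _ h'
        _ = C * M * Real.exp (w / 2 * (t - σ) + -w * (t - σ)) * ‖F σ‖ := by
            rw [Real.exp_add]
            ring
        _ ≤ C * M * Real.exp (w + -(w / 2) * (a + 1 - σ)) * ‖F σ‖ := by
            have h3 : w / 2 * (t - σ) + -w * (t - σ) ≤ w + -(w / 2) * (a + 1 - σ) := by
              nlinarith [ht.1]
            have h4 := Real.exp_le_exp.2 h3
            gcongr
        _ = _ := by
            rw [Real.exp_add]
            ring
    · rw [indicator_of_notMem h, norm_zero]
      refine mul_nonneg (by positivity) (indicator_nonneg (fun τ hτ => ?_) _)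
      exact mul_nonneg (gammaKernel_nonneg (le_of_lt hτ)) (norm_nonneg _)
  · have hne : ∀ᵐ σ : ℝ, σ ≠ a := by simp [ae_iff, measure_singleton]
    filter_upwards [hne] with σ hσ
    rcases lt_or_gt_of_ne hσ with h | h
    · have h1 : ContinuousAt (fun t => φ (t - σ) • S (t - σ) (F σ)) a := by
        have hpos : a - σ ∈ Ioi (0 : ℝ) := sub_pos.2 h
        have hsub : ContinuousAt (fun t : ℝ => t - σ) a := by fun_prop
        have e1 : ContinuousAt (fun t => φ (t - σ)) a :=
          ContinuousAt.comp (f := fun t : ℝ => t - σ) (g := φ)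
            (hφc.continuousAt (Ioi_mem_nhds hpos)) hsub
        have e2 : ContinuousAt (fun t => S (t - σ) (F σ)) a :=
          ContinuousAt.comp (f := fun t : ℝ => t - σ) (g := fun r => S r (F σ))
            ((hS.continuousOn_apply (F σ)).continuousAt (Ioi_mem_nhds hpos)) hsub
        exact e1.smul e2
      refine h1.congr ?_
      filter_upwards [Ioi_mem_nhds h] with t ht
      rw [indicator_of_mem (mem_Ioi.2 (sub_pos.2 (mem_Ioi.1 ht)))]
    · refine (continuousAt_const (y := (0 : X))).congr ?_
      filter_upwards [Iio_mem_nhds h] with t ht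
      rw [indicator_of_notMem]
      simpa using (le_of_lt ht)

theorem abs_rpow_sub_max_rpow_le {s r δ τ : ℝ} (hs : s < 1) (hr : r < s) (hδ : 0 < δ)
    (hτ : 0 < τ) : |τ ^ (s - 1) - max τ δ ^ (s - 1)| ≤ δ ^ (s - r) * τ ^ (r - 1) := by
  rcases le_total δ τ with h | h
  · rw [max_eq_left h, sub_self, abs_zero]
    positivity
  · rw [max_eq_right h]
    have h1 : δ ^ (s - 1) ≤ τ ^ (s - 1) := Real.rpow_le_rpow_of_nonpos hτ h (by linarith)
    rw [abs_of_nonneg (by linarith)]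
    calc τ ^ (s - 1) - δ ^ (s - 1) ≤ τ ^ (s - 1) := by
          have : 0 ≤ δ ^ (s - 1) := by positivity
          linarith
      _ = τ ^ (s - r) * τ ^ (r - 1) := by
          rw [← Real.rpow_add hτ]
          ring_nf
      _ ≤ _ := by
          gcongr

/-- For `s ≥ 1` the kernel is not singular. For `s < 1` it is cut off at `δ`. An exponent `r`
strictly between `1/p` and `s` is still admissible, so the cut-off error is of order `δ ^ (s - r)`
uniformly in `t`, and a uniform limit of continuous functions results. -/
theorem continuous_fracInt {S : ℝ → X →L[ℂ] X} (hS : IsMeasurableSemigroup S)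
    {M w : ℝ} (hM : ∀ t : ℝ, 0 ≤ t → ‖S t‖ ≤ M * Real.exp (-w * t)) (hw : 0 < w)
    {p : ENNReal} (hp : 1 ≤ p) {s : ℝ}
    (hs : (p = 1 ∧ 1 ≤ s) ∨ (p ≠ 1 ∧ p⁻¹.toReal < s)) {F : ℝ → X} (hF : MemLp F p volume) :
    Continuous (fracInt S s F) := by
  have hM0 := nonneg_of_stable hM
  have hpos := order_pos hs
  suffices h : Continuous fun t => ∫ τ in Ioi 0, τ ^ (s - 1) • S τ (F (t - τ)) by
    have : fracInt S s F = fun t =>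
        (1 / Real.Gamma s) • ∫ τ in Ioi 0, τ ^ (s - 1) • S τ (F (t - τ)) := by
      funext t
      rw [fracInt, if_neg hpos.ne']
    rw [this]
    exact h.const_smul _
  rcases le_or_gt 1 s with h1 | h1
  · obtain ⟨C, hC, h⟩ := exists_rpow_le_mul_exp (r := s - 1) (by linarith) (half_pos hw)
    refine continuous_integral_smul_apply hS hM hw (by fun_prop) ?_ hC.le (fun τ hτ => ?_) hp hF
    · exact fun τ hτ => (Real.continuousAt_rpow_const τ _ (Or.inl (ne_of_gt hτ))).continuousWithinAt
    · rw [abs_of_nonneg (by positivity)]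
      exact h τ hτ.le
  · have hp1 : p ≠ 1 ∧ p⁻¹.toReal < s := by
      rcases hs with h | h
      · linarith [h.2]
      · exact h
    obtain ⟨r, hr1, hr2⟩ := exists_between hp1.2
    obtain ⟨C, hC⟩ := exists_gammaKernel_bound hp hw (Or.inr ⟨hp1.1, hr1⟩) hF
    obtain ⟨C', hC'⟩ := exists_gammaKernel_bound hp hw hs hF
    let δ : ℕ → ℝ := fun n => 1 / ((n : ℝ) + 1)
    have hδ : ∀ n, 0 < δ n := fun n => Nat.one_div_pos_of_nat
    have hδ0 : Tendsto δ atTop (𝓝 0) := tendsto_one_div_add_atTop_nhds_zero_nat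
    have hcont : ∀ n, Continuous fun t =>
        ∫ τ in Ioi 0, (max τ (δ n)) ^ (s - 1) • S τ (F (t - τ)) := by
      intro n
      refine continuous_integral_smul_apply hS hM hw (by fun_prop) ?_
        (C := δ n ^ (s - 1)) (Real.rpow_nonneg (hδ n).le _) (fun τ hτ => ?_) hp hF
      · refine Continuous.continuousOn ?_
        refine Continuous.rpow_const (by fun_prop) fun τ => Or.inl ?_
        exact (lt_max_of_lt_right (hδ n)).ne'
      · rw [abs_of_nonneg (by positivity)]
        calc (max τ (δ n)) ^ (s - 1) ≤ δ n ^ (s - 1) :=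
              Real.rpow_le_rpow_of_nonpos (hδ n) (le_max_right _ _) (by linarith)
          _ ≤ δ n ^ (s - 1) * Real.exp (w / 2 * τ) := by
              refine le_mul_of_one_le_right (Real.rpow_nonneg (hδ n).le _) ?_
              rw [Real.one_le_exp_iff]
              positivity
    refine TendstoUniformly.continuous (F := fun n t =>
      ∫ τ in Ioi 0, (max τ (δ n)) ^ (s - 1) • S τ (F (t - τ))) (p := atTop) ?_
      (Frequently.of_forall hcont)
    have hlim : Tendsto (fun n => M * (δ n ^ (s - r) * C)) atTop (𝓝 0) := by
      have h2 : Tendsto (fun n => δ n ^ (s - r)) atTop (𝓝 0) := by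
        have := hδ0.rpow_const (p := s - r) (Or.inr (by linarith))
        rwa [Real.zero_rpow (by linarith)] at this
      simpa using (h2.mul_const C).const_mul M
    rw [Metric.tendstoUniformly_iff]
    intro ε hε
    filter_upwards [hlim.eventually (gt_mem_nhds hε)] with n hn t
    refine lt_of_le_of_lt ?_ hn
    have hle : ∀ τ ∈ Ioi (0 : ℝ), |τ ^ (s - 1) - max τ (δ n) ^ (s - 1)| * Real.exp (-w * τ) *
        ‖F (t - τ)‖ ≤ δ n ^ (s - r) * (gammaKernel w r τ * ‖F (t - τ)‖) := by
      intro τ hτ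
      calc _ ≤ (δ n ^ (s - r) * τ ^ (r - 1)) * Real.exp (-w * τ) * ‖F (t - τ)‖ := by
            gcongr
            exact abs_rpow_sub_max_rpow_le h1 hr2 (hδ n) hτ
        _ = _ := by
            rw [gammaKernel]
            ring
    have hmeas : AEStronglyMeasurable (fun τ => F (t - τ)) (volume.restrict (Ioi 0)) :=
      (aestronglyMeasurable_comp_sub_left hF.1 t).restrict
    have hI : IntegrableOn (fun τ => |τ ^ (s - 1) - max τ (δ n) ^ (s - 1)| *
        Real.exp (-w * τ) * ‖F (t - τ)‖) (Ioi 0) := by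
      refine Integrable.mono' ((hC t).1.const_mul (δ n ^ (s - r))) ?_ ?_
      · refine AEStronglyMeasurable.mul ?_ hmeas.norm
        refine Measurable.aestronglyMeasurable ?_
        fun_prop
      · filter_upwards [ae_restrict_mem measurableSet_Ioi] with τ hτ
        rw [Real.norm_of_nonneg (by positivity)]
        exact hle τ hτ
    have hI1 := integrableOn_smul_apply hS hM (φ := fun τ => τ ^ (s - 1)) (by fun_prop) hmeas
      (gammaKernel_integrableOn_iff.2 (hC' t).1)
    have hI2 := integrableOn_smul_apply hS hM
      (φ := fun τ => τ ^ (s - 1) - max τ (δ n) ^ (s - 1)) (by fun_prop) hmeas hI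
    have hI3 : IntegrableOn (fun τ => max τ (δ n) ^ (s - 1) • S τ (F (t - τ))) (Ioi 0) := by
      refine (hI1.sub hI2).congr (Eventually.of_forall fun τ => ?_)
      simp only [Pi.sub_apply, sub_smul]
      abel
    rw [dist_eq_norm, ← integral_sub hI1 hI3]
    simp only [← sub_smul]
    refine (norm_integral_smul_apply_le hM hI).trans ?_
    gcongr
    refine (setIntegral_mono_on hI ((hC t).1.const_mul _) measurableSet_Ioi hle).trans ?_
    rw [integral_const_mul]
    exact mul_le_mul_of_nonneg_left (hC t).2 (Real.rpow_nonneg (hδ n).le _)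

end

/-! ### The scalar identity -/

section

theorem integral_rpow_mul_sub_rpow {a b ρ : ℝ} (ha : 0 < a) (hb : 0 < b) (hρ : 0 < ρ) :
    ∫ τ in Ioo 0 ρ, τ ^ (a - 1) * (ρ - τ) ^ (b - 1) =
      ρ ^ (a + b - 1) * (Real.Gamma a * Real.Gamma b / Real.Gamma (a + b)) := by
  have h := Complex.betaIntegral_scaled (a : ℂ) (b : ℂ) hρ
  rw [intervalIntegral.integral_of_le hρ.le, integral_Ioc_eq_integral_Ioo,
    Complex.betaIntegral_eq_Gamma_mul_div _ _ (by simpa using ha) (by simpa using hb)] at h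
  have h2 : ∫ x in Ioo 0 ρ, (x : ℂ) ^ ((a : ℂ) - 1) * ((ρ : ℂ) - x) ^ ((b : ℂ) - 1) =
      ∫ x in Ioo 0 ρ, ((x ^ (a - 1) * (ρ - x) ^ (b - 1) : ℝ) : ℂ) := by
    refine setIntegral_congr_fun measurableSet_Ioo fun x hx => ?_
    simp only [Complex.ofReal_mul]
    rw [Complex.ofReal_cpow hx.1.le, Complex.ofReal_cpow (sub_nonneg.2 hx.2.le)]
    push_cast
    rfl
  rw [h2, integral_complex_ofReal] at h
  rw [← Complex.ofReal_inj, h]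
  simp_rw [Complex.ofReal_mul, Complex.ofReal_div, Complex.ofReal_mul, ← Complex.Gamma_ofReal]
  rw [Complex.ofReal_cpow hρ.le]
  push_cast
  rfl

theorem integrableOn_rpow_mul_sub_rpow {a b ρ : ℝ} (ha : 0 < a) (hb : 0 < b) (hρ : 0 < ρ) :
    IntegrableOn (fun τ => τ ^ (a - 1) * (ρ - τ) ^ (b - 1)) (Ioo 0 ρ) := by
  -- A non-integrable function has Bochner integral zero by convention, whereas the Beta value is
  -- positive.
  by_contra h
  have h1 := integral_undef h
  rw [integral_rpow_mul_sub_rpow ha hb hρ] at h1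
  have := Real.Gamma_pos_of_pos ha
  have := Real.Gamma_pos_of_pos hb
  have := Real.Gamma_pos_of_pos (add_pos ha hb)
  have : 0 < ρ ^ (a + b - 1) * (Real.Gamma a * Real.Gamma b / Real.Gamma (a + b)) := by positivity
  linarith

theorem integrableOn_rpow_div_mul_sub_rpow {a s x : ℝ} (ha : a < 1) (hs : 0 < s) (hx : 0 < x) :
    IntegrableOn (fun τ => τ ^ (-a) / (τ + 1) * (x - τ) ^ (s - 1)) (Ioo 0 x) := by
  have h := integrableOn_rpow_mul_sub_rpow (a := 1 - a) (by linarith) hs hx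
  refine Integrable.mono' h (Measurable.aestronglyMeasurable (by fun_prop)) ?_
  filter_upwards [ae_restrict_mem measurableSet_Ioo] with τ hτ
  have h1 : 0 < τ := hτ.1
  have h2 : 0 < x - τ := sub_pos.2 hτ.2
  rw [Real.norm_of_nonneg (by positivity), show 1 - a - 1 = -a by ring]
  gcongr
  exact div_le_self (by positivity) (by linarith)

/-- The Möbius substitution `τ ↦ τ (1 + x) / (x (1 + τ))` maps `(0, x)` onto `(0, 1)` and produces
the Beta integral with parameters `1 - a` and `a`, evaluated by Euler's reflection formula. -/
theorem integral_rpow_div_mul_sub_rpow {a x : ℝ} (ha : 0 < a) (ha1 : a < 1) (hx : 0 < x) :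
    ∫ τ in Ioo 0 x, τ ^ (-a) / (τ + 1) * (x - τ) ^ (a - 1) =
      Real.pi / Real.sin (Real.pi * a) * (1 + x) ^ (a - 1) := by
  let φ : ℝ → ℝ := fun τ => τ * (1 + x) / (x * (1 + τ))
  have himg : φ '' Ioo 0 x = Ioo 0 1 := by
    ext z
    constructor
    · rintro ⟨τ, ⟨h1, h2⟩, rfl⟩
      refine ⟨by positivity, ?_⟩
      rw [div_lt_one (by positivity)]
      nlinarith
    · rintro ⟨h1, h2⟩
      have h3 : 0 < 1 + x - x * z := by nlinarith
      refine ⟨x * z / (1 + x - x * z), ⟨by positivity, ?_⟩, ?_⟩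
      · rw [div_lt_iff₀ h3]
        nlinarith [mul_pos hx (mul_pos (add_pos one_pos hx) (sub_pos.2 h2))]
      · simp only [φ]
        field_simp
        ring
  have hder : ∀ τ ∈ Ioo 0 x,
      HasDerivWithinAt φ ((1 + x) / (x * (1 + τ) ^ 2)) (Ioo 0 x) τ := by
    intro τ hτ
    have h1 : 0 < τ := hτ.1
    have h2 : HasDerivAt φ (((1 * (1 + x)) * (x * (1 + τ)) - τ * (1 + x) * (x * 1)) /
        (x * (1 + τ)) ^ 2) τ :=
      ((hasDerivAt_id τ).mul_const (1 + x)).div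
        (((hasDerivAt_id τ).const_add 1).const_mul x) (by positivity)
    refine HasDerivAt.hasDerivWithinAt ?_
    convert! h2 using 1
    field_simp
    ring
  have hinj : InjOn φ (Ioo 0 x) := by
    intro u hu v hv huv
    have h1 : 0 < u := hu.1
    have h2 : 0 < v := hv.1
    simp only [φ] at huv
    rw [div_eq_div_iff (by positivity) (by positivity)] at huv
    have h3 : (x * (1 + x)) * u = (x * (1 + x)) * v := by linarith
    exact mul_left_cancel₀ (by positivity) h3
  have hB := integral_rpow_mul_sub_rpow (a := 1 - a) (b := a) (by linarith) ha one_pos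
  rw [Real.one_rpow, one_mul, sub_add_cancel, Real.Gamma_one, div_one,
    mul_comm (Real.Gamma _), Real.Gamma_mul_Gamma_one_sub] at hB
  have hC := integral_image_eq_integral_abs_deriv_smul measurableSet_Ioo hder hinj
    (fun z => z ^ (1 - a - 1) * (1 - z) ^ (a - 1))
  rw [himg, hB] at hC
  have hD : ∫ τ in Ioo 0 x, |(1 + x) / (x * (1 + τ) ^ 2)| •
      (φ τ ^ (1 - a - 1) * (1 - φ τ) ^ (a - 1)) =
      ∫ τ in Ioo 0 x, (1 + x) ^ (1 - a) * (τ ^ (-a) / (τ + 1) * (x - τ) ^ (a - 1)) := by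
    refine setIntegral_congr_fun measurableSet_Ioo fun τ hτ => ?_
    have h1 : 0 < τ := hτ.1
    have h2 : 0 < x - τ := sub_pos.2 hτ.2
    have h3 : 1 - φ τ = (x - τ) / (x * (1 + τ)) := by
      simp only [φ]
      field_simp
      ring
    simp only [smul_eq_mul]
    rw [h3, abs_of_pos (by positivity), show 1 - a - 1 = -a by ring]
    simp only [φ]
    rw [Real.div_rpow (by positivity) (by positivity), Real.div_rpow h2.le (by positivity),
      Real.mul_rpow h1.le (by positivity), Real.mul_rpow hx.le (by positivity),
      Real.mul_rpow hx.le (by positivity)]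
    have e2 : x ^ (-a) * x ^ (a - 1) = x⁻¹ := by
      rw [← Real.rpow_add hx, ← Real.rpow_neg_one]
      ring_nf
    have e3 : (1 + τ) ^ (-a) * (1 + τ) ^ (a - 1) = (1 + τ)⁻¹ := by
      rw [← Real.rpow_add (by positivity), ← Real.rpow_neg_one]
      ring_nf
    have e4 : (1 + x) ^ (1 - a) = (1 + x) * (1 + x) ^ (-a) := by
      rw [sub_eq_add_neg, Real.rpow_add (by positivity), Real.rpow_one]
    have e5 : (1 + x) / (x * (1 + τ) ^ 2) * (τ ^ (-a) * (1 + x) ^ (-a) /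
        (x ^ (-a) * (1 + τ) ^ (-a)) * ((x - τ) ^ (a - 1) / (x ^ (a - 1) * (1 + τ) ^ (a - 1)))) =
        (1 + x) / (x * (1 + τ) ^ 2) * (τ ^ (-a) * (1 + x) ^ (-a) * (x - τ) ^ (a - 1) /
        ((x ^ (-a) * x ^ (a - 1)) * ((1 + τ) ^ (-a) * (1 + τ) ^ (a - 1)))) := by
      rw [div_mul_div_comm, mul_mul_mul_comm (x ^ (-a))]
    rw [e5, e2, e3, e4]
    field_simp
    ring
  rw [hD, integral_const_mul] at hC
  rw [hC, mul_right_comm, ← Real.rpow_add (by positivity)]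
  simp

/-- In reciprocal form the functional equation needs no exception at `y = 0`, since `Real.Gamma 0 =
0`. Pascal's rule uses it at `s - (j + 1)`, which may vanish or be negative. -/
theorem inv_Gamma_eq (y : ℝ) : (Real.Gamma y)⁻¹ = y * (Real.Gamma (y + 1))⁻¹ := by
  by_cases h : y = 0
  · simp [h]
  · rw [Real.Gamma_add_one h, mul_inv, mul_inv_cancel_left₀ h]

/-- The generalized binomial coefficient `(s - 1).choose j`, expressed by Gamma functions. -/
def gammaChoose (s : ℝ) (j : ℕ) : ℝ := Real.Gamma s * ((Real.Gamma (s - j))⁻¹ *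
  (Real.Gamma (j + 1))⁻¹)

theorem gammaChoose_zero {s : ℝ} (hs : 0 < s) : gammaChoose s 0 = 1 := by
  have := (Real.Gamma_pos_of_pos hs).ne'
  simp [gammaChoose, this]

theorem gammaChoose_succ {s : ℝ} (hs : 0 < s) (j : ℕ) :
    gammaChoose (s + 1) (j + 1) = gammaChoose s (j + 1) + gammaChoose s j := by
  unfold gammaChoose
  have h1 : Real.Gamma ((j : ℝ) + 1 + 1) = (j + 1) * Real.Gamma (j + 1) :=
    Real.Gamma_add_one (by positivity)
  have h2 : Real.Gamma ((j : ℝ) + 1) ≠ 0 := (Real.Gamma_pos_of_pos (by positivity)).ne'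
  have h3 := inv_Gamma_eq (s - (j + 1))
  rw [show s - (j + 1) + 1 = s - j by ring] at h3
  push_cast
  rw [show s + 1 - ((j : ℝ) + 1) = s - j by ring, Real.Gamma_add_one hs.ne', h3, h1]
  field_simp
  ring

theorem sum_gammaChoose_succ {s : ℝ} (hs : 0 < s) (n : ℕ) (x : ℝ) :
    ∑ j ∈ Finset.range (n + 1), gammaChoose (s + 1) j * x ^ j =
      (1 + x) * ∑ j ∈ Finset.range n, gammaChoose s j * x ^ j + gammaChoose s n * x ^ n := by
  rw [Finset.sum_range_succ', gammaChoose_zero (by linarith)]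
  have h1 : ∑ j ∈ Finset.range n, gammaChoose s j * x ^ j + gammaChoose s n * x ^ n =
      ∑ j ∈ Finset.range n, gammaChoose s (j + 1) * x ^ (j + 1) + 1 := by
    rw [← Finset.sum_range_succ, Finset.sum_range_succ', gammaChoose_zero hs]
    simp
  have h2 : ∑ j ∈ Finset.range n, gammaChoose (s + 1) (j + 1) * x ^ (j + 1) =
      ∑ j ∈ Finset.range n, gammaChoose s (j + 1) * x ^ (j + 1) +
        x * ∑ j ∈ Finset.range n, gammaChoose s j * x ^ j := by
    rw [Finset.mul_sum, ← Finset.sum_add_distrib]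
    refine Finset.sum_congr rfl fun j _ => ?_
    rw [gammaChoose_succ hs]
    ring
  rw [h2]
  linear_combination -h1

/-- In the induction step one factor `x - τ` is split as `(1 + x) - (1 + τ)`. The first part
reproduces the previous integral times `1 + x`; the second cancels the denominator and leaves a Beta
integral, which supplies the new top coefficient. Pascal's rule matches the sums. -/
theorem one_add_rpow_eq_range {a x : ℝ} (ha0 : 0 ≤ a) (ha1 : a < 1) (hx : 0 < x) (n : ℕ)
    (hn : 0 < n + a) :
    Real.sin (Real.pi * a) / Real.pi *
        (∫ τ in Ioo 0 x, τ ^ (-a) / (τ + 1) * (x - τ) ^ (n + a - 1)) +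
      ∑ j ∈ Finset.range n, gammaChoose (n + a) j * x ^ j = (1 + x) ^ (n + a - 1) := by
  induction n with
  | zero =>
    have ha : 0 < a := by simpa using hn
    have hsin : 0 < Real.sin (Real.pi * a) :=
      Real.sin_pos_of_pos_of_lt_pi (by positivity) (by nlinarith [Real.pi_pos])
    simp only [Nat.cast_zero, zero_add, Finset.range_zero, Finset.sum_empty, add_zero]
    rw [integral_rpow_div_mul_sub_rpow ha ha1 hx]
    field_simp
  | succ n ih =>
    -- The induction hypothesis is void at `n = a = 0`, so total order `1` is a second base case.
    rcases eq_or_lt_of_le (show (0 : ℝ) ≤ n + a by positivity) with h0 | h0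
    · have hn0 : (n : ℝ) = 0 := by linarith [(Nat.cast_nonneg n : (0 : ℝ) ≤ n)]
      have ha : a = 0 := by linarith
      have hn0' : n = 0 := by exact_mod_cast hn0
      subst ha hn0'
      simp [gammaChoose_zero]
    · have ih' := ih h0
      have hB := integral_rpow_mul_sub_rpow (a := 1 - a) (by linarith) h0 hx
      have hI := integrableOn_rpow_mul_sub_rpow (a := 1 - a) (by linarith) h0 hx
      have hI2 := integrableOn_rpow_div_mul_sub_rpow ha1 h0 hx
      have hrec : ∫ τ in Ioo 0 x, τ ^ (-a) / (τ + 1) * (x - τ) ^ (n + a) =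
          (1 + x) * (∫ τ in Ioo 0 x, τ ^ (-a) / (τ + 1) * (x - τ) ^ (n + a - 1)) -
          ∫ τ in Ioo 0 x, τ ^ (1 - a - 1) * (x - τ) ^ (n + a - 1) := by
        rw [← integral_const_mul, ← integral_sub (hI2.const_mul _) hI]
        refine setIntegral_congr_fun measurableSet_Ioo fun τ hτ => ?_
        have h1 : 0 < τ := hτ.1
        have h2 : 0 < x - τ := sub_pos.2 hτ.2
        rw [show 1 - a - 1 = -a by ring, show (n : ℝ) + a = (n + a - 1) + 1 by ring,
          Real.rpow_add_one h2.ne', add_sub_cancel_right]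
        field_simp
        ring
      have hcoef : Real.sin (Real.pi * a) / Real.pi *
          (Real.Gamma (1 - a) * Real.Gamma (n + a) / Real.Gamma (1 - a + (n + a))) =
          gammaChoose (n + a) n := by
        rw [gammaChoose, show 1 - a + (n + a) = n + 1 by ring, add_sub_cancel_left]
        -- Euler's reflection formula; at `a = 0` both sides vanish because `Real.Gamma 0 = 0`.
        have href : Real.sin (Real.pi * a) / Real.pi * Real.Gamma (1 - a) =
            (Real.Gamma a)⁻¹ := by
          rcases eq_or_lt_of_le ha0 with ha | ha
          · simp [← ha]
          · have h1 := Real.Gamma_mul_Gamma_one_sub a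
            have hsin : 0 < Real.sin (Real.pi * a) :=
              Real.sin_pos_of_pos_of_lt_pi (by positivity) (by nlinarith [Real.pi_pos])
            have hG := (Real.Gamma_pos_of_pos ha).ne'
            refine eq_inv_of_mul_eq_one_left ?_
            rw [mul_right_comm, mul_assoc, h1]
            field_simp
        rw [← href]
        ring
      push_cast
      rw [show (n : ℝ) + 1 + a - 1 = n + a by ring, show (n : ℝ) + 1 + a = n + a + 1 by ring,
        sum_gammaChoose_succ h0, hrec, hB, show 1 - a + (n + a) - 1 = n by ring,
        Real.rpow_natCast, ← hcoef]
      have hlast : (1 + x) ^ ((n : ℝ) + a) = (1 + x) * (1 + x) ^ ((n : ℝ) + a - 1) := by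
        rw [mul_comm, ← Real.rpow_add_one (by positivity)]
        ring_nf
      rw [hlast, ← ih']
      rw [show 1 - a + (n + a) = n + 1 by ring]
      ring

theorem one_add_rpow_eq {s x : ℝ} (hs : 0 < s) (hx : 0 < x) :
    Real.sin (Real.pi * Int.fract s) / Real.pi *
        (∫ τ in Ioo 0 x, τ ^ (-Int.fract s) / (τ + 1) * (x - τ) ^ (s - 1)) +
      ∑ k ∈ Finset.Icc 1 ⌊s⌋₊, Real.Gamma s / (Real.Gamma (Int.fract s + k) *
        Real.Gamma ((⌊s⌋₊ : ℝ) - k + 1)) * x ^ ((⌊s⌋₊ : ℝ) - k) = (1 + x) ^ (s - 1) := by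
  have hfl : (⌊s⌋₊ : ℝ) + Int.fract s = s := by
    rw [natCast_floor_eq_intCast_floor hs.le, Int.floor_add_fract]
  have h := one_add_rpow_eq_range (Int.fract_nonneg s) (Int.fract_lt_one s) hx ⌊s⌋₊
    (by rw [hfl]; exact hs)
  rw [hfl] at h
  rw [← h]
  congr 1
  refine Finset.sum_nbij' (fun k => ⌊s⌋₊ - k) (fun j => ⌊s⌋₊ - j) ?_ ?_ ?_ ?_ ?_
  · intro k hk
    simp only [Finset.mem_Icc, Finset.mem_range] at hk ⊢
    omega
  · intro k hk
    simp only [Finset.mem_Icc, Finset.mem_range] at hk ⊢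
    omega
  · intro k hk
    simp only [Finset.mem_Icc] at hk
    omega
  · intro k hk
    simp only [Finset.mem_range] at hk
    omega
  · intro k hk
    rw [Finset.mem_Icc] at hk
    simp only [gammaChoose]
    rw [← Nat.cast_sub hk.2, Real.rpow_natCast, Nat.cast_sub hk.2, div_eq_mul_inv, mul_inv]
    congr 5
    linarith

end

/-! ### Iterated fractional integrals -/

section

section Fubini

variable {E : Type*} [NormedAddCommGroup E] [NormedSpace ℝ E] [CompleteSpace E]

/-- Fubini on the cone `0 < τ < ρ` with `ρ = τ + σ`: integrating out `τ` first replaces the two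
kernels by their convolution `K`. Nonnegativity of the kernels makes integrability of `K * ‖G‖`
sufficient. Strict positivity of `k₁` allows it to be divided out of the inner integrability
statement. -/
theorem integral_mul_integral_add {k₁ k₂ K : ℝ → ℝ} (hk₁ : Measurable k₁) (hk₂ : Measurable k₂)
    (h₁ : ∀ τ, 0 < τ → 0 < k₁ τ) (h₂ : ∀ τ, 0 < τ → 0 ≤ k₂ τ)
    (hkI : ∀ ρ, 0 < ρ → IntegrableOn (fun τ => k₁ τ * k₂ (ρ - τ)) (Ioo 0 ρ))
    (hK : ∀ ρ, 0 < ρ → ∫ τ in Ioo 0 ρ, k₁ τ * k₂ (ρ - τ) = K ρ)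
    {G : ℝ → E} (hG : AEStronglyMeasurable G (volume.restrict (Ioi 0)))
    (hKG : IntegrableOn (fun ρ => K ρ * ‖G ρ‖) (Ioi 0)) :
    (∀ᵐ τ ∂volume.restrict (Ioi 0), IntegrableOn (fun σ => k₂ σ • G (τ + σ)) (Ioi 0)) ∧
    IntegrableOn (fun τ => k₁ τ • ∫ σ in Ioi 0, k₂ σ • G (τ + σ)) (Ioi 0) ∧
    ∫ τ in Ioi 0, k₁ τ • ∫ σ in Ioi 0, k₂ σ • G (τ + σ) = ∫ ρ in Ioi 0, K ρ • G ρ := by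
  have hG0 : AEStronglyMeasurable ((Ioi 0).indicator G) volume :=
    (aestronglyMeasurable_indicator_iff measurableSet_Ioi).2 hG
  let D : Set (ℝ × ℝ) := {z | 0 < z.1 ∧ z.1 < z.2}
  have hD : MeasurableSet D :=
    (measurableSet_lt measurable_const measurable_fst).inter
      (measurableSet_lt measurable_fst measurable_snd)
  let c : ℝ × ℝ → ℝ := D.indicator fun z => k₁ z.1 * k₂ (z.2 - z.1)
  have hc : Measurable c := by
    refine Measurable.indicator ?_ hD
    fun_prop
  let Ψ : ℝ → ℝ → E := fun τ ρ => c (τ, ρ) • (Ioi 0).indicator G ρ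
  have hΨm : AEStronglyMeasurable (Function.uncurry Ψ) (volume.prod volume) :=
    hc.aestronglyMeasurable.smul hG0.comp_snd
  have hcρ : ∀ ρ, (fun τ => c (τ, ρ)) = (Ioo 0 ρ).indicator fun τ => k₁ τ * k₂ (ρ - τ) := by
    intro ρ
    funext τ
    by_cases h : 0 < τ ∧ τ < ρ
    · have h1 : (τ, ρ) ∈ D := h
      have h2 : τ ∈ Ioo 0 ρ := h
      simp only [c, indicator_of_mem h1, indicator_of_mem h2]
    · have h1 : (τ, ρ) ∉ D := h
      have h2 : τ ∉ Ioo 0 ρ := h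
      simp only [c, indicator_of_notMem h1, indicator_of_notMem h2]
  have hcnn : ∀ τ ρ, 0 ≤ c (τ, ρ) := by
    intro τ ρ
    refine indicator_nonneg (fun z hz => ?_) _
    exact mul_nonneg (h₁ _ hz.1).le (h₂ _ (sub_pos.2 hz.2))
  have hcI : ∀ ρ, Integrable fun τ => c (τ, ρ) := by
    intro ρ
    rw [hcρ, integrable_indicator_iff measurableSet_Ioo]
    rcases lt_or_ge 0 ρ with h | h
    · exact hkI ρ h
    · simp [Ioo_eq_empty_of_le h]
  have hcint : ∀ ρ, 0 < ρ → ∫ τ, c (τ, ρ) = K ρ := by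
    intro ρ hρ
    rw [hcρ, integral_indicator measurableSet_Ioo, hK ρ hρ]
  have hinner : ∀ ρ, ∫ τ, Ψ τ ρ = (Ioi 0).indicator (fun ρ => K ρ • G ρ) ρ := by
    intro ρ
    simp only [Ψ]
    rw [integral_smul_const]
    by_cases h : ρ ∈ Ioi (0 : ℝ)
    · rw [indicator_of_mem h, indicator_of_mem h, hcint ρ h]
    · rw [indicator_of_notMem h, indicator_of_notMem h, smul_zero]
  have hnorm : ∀ ρ, ∫ τ, ‖Ψ τ ρ‖ = (Ioi 0).indicator (fun ρ => K ρ * ‖G ρ‖) ρ := by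
    intro ρ
    simp only [Ψ, norm_smul, Real.norm_of_nonneg (hcnn _ _)]
    rw [integral_mul_const]
    by_cases h : ρ ∈ Ioi (0 : ℝ)
    · rw [indicator_of_mem h, indicator_of_mem h, hcint ρ h]
    · rw [indicator_of_notMem h, indicator_of_notMem h, norm_zero, mul_zero]
  have hΨ : Integrable (Function.uncurry Ψ) (volume.prod volume) := by
    rw [integrable_prod_iff' hΨm]
    refine ⟨Eventually.of_forall fun ρ => (hcI ρ).smul_const ((Ioi 0).indicator G ρ), ?_⟩
    simp only [Function.uncurry_apply_pair, hnorm]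
    exact (integrable_indicator_iff measurableSet_Ioi).2 hKG
  have hshift : ∀ τ, 0 < τ → (fun σ => Ψ τ (τ + σ)) =
      (Ioi 0).indicator fun σ => k₁ τ • k₂ σ • G (τ + σ) := by
    intro τ hτ
    funext σ
    by_cases h : σ ∈ Ioi (0 : ℝ)
    · have h0 : 0 < σ := h
      have h1 : (τ, τ + σ) ∈ D := ⟨hτ, by simpa using h0⟩
      have h2 : τ + σ ∈ Ioi (0 : ℝ) := add_pos hτ h0
      simp only [Ψ, c, indicator_of_mem h1, indicator_of_mem h2, indicator_of_mem h,
        add_sub_cancel_left, mul_smul]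
    · have h1 : (τ, τ + σ) ∉ D := fun h' => h (by simpa using h'.2)
      simp only [Ψ, c, indicator_of_notMem h1, indicator_of_notMem h, zero_smul]
  have houter : ∀ τ, ∫ ρ, Ψ τ ρ =
      (Ioi 0).indicator (fun τ => k₁ τ • ∫ σ in Ioi 0, k₂ σ • G (τ + σ)) τ := by
    intro τ
    by_cases h : τ ∈ Ioi (0 : ℝ)
    · rw [indicator_of_mem h, ← integral_add_left_eq_self (fun ρ => Ψ τ ρ) τ, hshift τ h,
        integral_indicator measurableSet_Ioi, integral_smul]
    · have h0 : ∀ ρ, Ψ τ ρ = 0 := by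
        intro ρ
        have h1 : (τ, ρ) ∉ D := fun h' => h h'.1
        simp only [Ψ, c, indicator_of_notMem h1, zero_smul]
      simp only [h0, integral_zero, indicator_of_notMem h]
  refine ⟨?_, ?_, ?_⟩
  · rw [ae_restrict_iff' measurableSet_Ioi]
    filter_upwards [hΨ.prod_right_ae] with τ h hτ
    have h1 : Integrable fun σ => Ψ τ (τ + σ) := Integrable.comp_add_left h τ
    rw [hshift τ hτ, integrable_indicator_iff measurableSet_Ioi] at h1
    refine (h1.smul (k₁ τ)⁻¹).congr (Eventually.of_forall fun σ => ?_)
    simp only [Pi.smul_apply]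
    rw [smul_smul, inv_mul_cancel₀ (h₁ τ hτ).ne', one_smul]
  · have h := hΨ.integral_prod_left
    simp only [Function.uncurry_apply_pair, houter] at h
    exact (integrable_indicator_iff measurableSet_Ioi).1 h
  · rw [← integral_indicator measurableSet_Ioi, ← integral_indicator measurableSet_Ioi]
    simp_rw [← houter, ← hinner]
    exact integral_integral_swap hΨ

end Fubini

variable {X : Type*} [NormedAddCommGroup X] [NormedSpace ℂ X]

/-- The semigroup law merges `S (T + τ)` and `S σ`, so both sides integrate the single function `ρ ↦
S (T + ρ) (F (t - ρ))`. With `T = 0` and power kernels this gives the additivity of orders; with `T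
> 0` it serves the formula to the right of `t₀`. -/
theorem integral_smul_apply_integral [CompleteSpace X] {S : ℝ → X →L[ℂ] X}
    (hS : IsMeasurableSemigroup S) {M w : ℝ}
    (hM : ∀ t : ℝ, 0 ≤ t → ‖S t‖ ≤ M * Real.exp (-w * t)) (hw : 0 < w) {T : ℝ} (hT : 0 ≤ T)
    {k₁ k₂ K : ℝ → ℝ} (hk₁ : Measurable k₁) (hk₂ : Measurable k₂) (hKm : Measurable K)
    (h₁ : ∀ τ, 0 < τ → 0 < k₁ τ) (h₂ : ∀ τ, 0 < τ → 0 ≤ k₂ τ)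
    (hkI : ∀ ρ, 0 < ρ → IntegrableOn (fun τ => k₁ τ * k₂ (ρ - τ)) (Ioo 0 ρ))
    (hK : ∀ ρ, 0 < ρ → ∫ τ in Ioo 0 ρ, k₁ τ * k₂ (ρ - τ) = K ρ)
    {F : ℝ → X} (hF : AEStronglyMeasurable F volume) {t : ℝ}
    (hKF : IntegrableOn (fun ρ => K ρ * (Real.exp (-w * ρ) * ‖F (t - ρ)‖)) (Ioi 0)) :
    IntegrableOn (fun τ => k₁ τ • S (T + τ) (∫ σ in Ioi 0, k₂ σ • S σ (F (t - τ - σ))))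
      (Ioi 0) ∧
    ∫ τ in Ioi 0, k₁ τ • S (T + τ) (∫ σ in Ioi 0, k₂ σ • S σ (F (t - τ - σ))) =
      ∫ ρ in Ioi 0, K ρ • S (T + ρ) (F (t - ρ)) := by
  have hM0 := nonneg_of_stable hM
  have hFt : AEStronglyMeasurable (fun τ => F (t - τ)) (volume.restrict (Ioi 0)) :=
    (aestronglyMeasurable_comp_sub_left hF t).restrict
  have hG : AEStronglyMeasurable (fun ρ => S (T + ρ) (F (t - ρ))) (volume.restrict (Ioi 0)) :=
    hS.aestronglyMeasurable_apply_add hT hFt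
  have hg : AEStronglyMeasurable (fun ρ => Real.exp (-w * ρ) * ‖F (t - ρ)‖)
      (volume.restrict (Ioi 0)) :=
    (Measurable.aestronglyMeasurable (by fun_prop)).mul hFt.norm
  have hKnn : ∀ ρ, 0 < ρ → 0 ≤ K ρ := by
    intro ρ hρ
    rw [← hK ρ hρ]
    refine setIntegral_nonneg measurableSet_Ioo fun τ hτ => ?_
    exact mul_nonneg (h₁ _ hτ.1).le (h₂ _ (sub_pos.2 hτ.2))
  have hKG : IntegrableOn (fun ρ => K ρ * ‖S (T + ρ) (F (t - ρ))‖) (Ioi 0) := by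
    refine (hKF.const_mul M).mono' (hKm.aestronglyMeasurable.mul hG.norm) ?_
    filter_upwards [ae_restrict_mem measurableSet_Ioi] with ρ hρ
    have hρ' : (0 : ℝ) < ρ := hρ
    have hK0 := hKnn ρ hρ'
    rw [Real.norm_of_nonneg (by positivity)]
    calc K ρ * ‖S (T + ρ) (F (t - ρ))‖ ≤
        K ρ * (M * Real.exp (-w * (T + ρ)) * ‖F (t - ρ)‖) := by
          gcongr
          exact (S _).le_of_opNorm_le (hM _ (by positivity)) _
      _ ≤ K ρ * (M * Real.exp (-w * ρ) * ‖F (t - ρ)‖) := by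
          have h3 : Real.exp (-w * (T + ρ)) ≤ Real.exp (-w * ρ) :=
            Real.exp_le_exp.2 (by nlinarith)
          gcongr
      _ = _ := by ring
  have hKF' : IntegrableOn (fun ρ => K ρ * ‖Real.exp (-w * ρ) * ‖F (t - ρ)‖‖) (Ioi 0) := by
    refine hKF.congr_fun (fun ρ _ => ?_) measurableSet_Ioi
    rw [Real.norm_of_nonneg (by positivity)]
  obtain ⟨-, hA2, hA3⟩ := integral_mul_integral_add hk₁ hk₂ h₁ h₂ hkI hK hG hKG
  -- The second application is to the scalar majorant. Pulling `S (T + τ)` out of the inner integral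
  -- requires integrability before `S (T + τ)` is applied, which the first application does not
  -- give.
  obtain ⟨hB1, -, -⟩ := integral_mul_integral_add hk₁ hk₂ h₁ h₂ hkI hK hg hKF'
  have hcongr : ∀ᵐ τ ∂volume.restrict (Ioi 0),
      k₁ τ • ∫ σ in Ioi 0, k₂ σ • S (T + (τ + σ)) (F (t - (τ + σ))) =
      k₁ τ • S (T + τ) (∫ σ in Ioi 0, k₂ σ • S σ (F (t - τ - σ))) := by
    filter_upwards [hB1, ae_restrict_mem measurableSet_Ioi] with τ hτ hτ0
    have hτ0' : (0 : ℝ) < τ := hτ0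
    have hint : IntegrableOn (fun σ => k₂ σ • S σ (F (t - τ - σ))) (Ioi 0) := by
      refine integrableOn_smul_apply hS hM hk₂
        (aestronglyMeasurable_comp_sub_left hF (t - τ)).restrict ?_
      refine IntegrableOn.congr_fun (hτ.const_mul (Real.exp (w * τ))) (fun σ hσ => ?_)
        measurableSet_Ioi
      have hσ' : (0 : ℝ) < σ := hσ
      simp only [smul_eq_mul]
      rw [abs_of_nonneg (h₂ σ hσ'), sub_sub,
        show Real.exp (-w * σ) = Real.exp (w * τ) * Real.exp (-w * (τ + σ)) by
          rw [← Real.exp_add]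
          ring_nf]
      ring
    congr 1
    rw [← ContinuousLinearMap.integral_comp_comm _ hint]
    refine setIntegral_congr_fun measurableSet_Ioi fun σ hσ => ?_
    rw [ContinuousLinearMap.map_smul_of_tower, ← add_assoc, sub_sub,
      hS.map_add (T + τ) σ (by positivity) (le_of_lt hσ)]
    rfl
  exact ⟨Integrable.congr hA2 hcongr, by rw [← hA3]; exact (integral_congr_ae hcongr).symm⟩

theorem fracInt_fracInt [CompleteSpace X] {S : ℝ → X →L[ℂ] X}
    (hS : IsMeasurableSemigroup S) {M w : ℝ}
    (hM : ∀ t : ℝ, 0 ≤ t → ‖S t‖ ≤ M * Real.exp (-w * t)) (hw : 0 < w) {a b : ℝ} (ha : 0 < a)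
    (hb : 0 < b) {F : ℝ → X} (hF : AEStronglyMeasurable F volume) {t : ℝ}
    (h : IntegrableOn (fun ρ => gammaKernel w (a + b) ρ * ‖F (t - ρ)‖) (Ioi 0)) :
    fracInt S a (fracInt S b F) t = fracInt S (a + b) F t := by
  have hGa := Real.Gamma_pos_of_pos ha
  have hGb := Real.Gamma_pos_of_pos hb
  have hGab := Real.Gamma_pos_of_pos (add_pos ha hb)
  have hKF : IntegrableOn (fun ρ => ρ ^ (a + b - 1) *
      (Real.Gamma a * Real.Gamma b / Real.Gamma (a + b)) *
      (Real.exp (-w * ρ) * ‖F (t - ρ)‖)) (Ioi 0) := by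
    refine (h.const_mul (Real.Gamma a * Real.Gamma b / Real.Gamma (a + b))).congr
      (Eventually.of_forall fun ρ => ?_)
    simp only [gammaKernel]
    ring
  obtain ⟨-, h1⟩ := integral_smul_apply_integral hS hM hw le_rfl
    (k₁ := fun τ => τ ^ (a - 1)) (k₂ := fun τ => τ ^ (b - 1)) (by fun_prop) (by fun_prop)
    (by fun_prop) (fun τ hτ => by positivity) (fun τ hτ => by positivity)
    (fun ρ hρ => integrableOn_rpow_mul_sub_rpow ha hb hρ)
    (fun ρ hρ => integral_rpow_mul_sub_rpow ha hb hρ) hF hKF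
  simp only [zero_add] at h1
  simp only [fracInt, if_neg ha.ne', if_neg hb.ne', if_neg (add_pos ha hb).ne',
    ContinuousLinearMap.map_smul_of_tower, smul_comm _ (1 / Real.Gamma b)]
  rw [integral_smul, h1, smul_smul, ← integral_smul, ← integral_smul]
  refine setIntegral_congr_fun measurableSet_Ioi fun ρ hρ => ?_
  simp only [smul_smul]
  congr 1
  field_simp

end

/-! ### Extension by zero -/

section

/-- The scalar coefficient of the `k`-th term in the solution formula, including the
normalization of the fractional integral of order `⌊s⌋ - k + 1`. -/
def sumCoeff (s T : ℝ) (k : ℕ) : ℝ :=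
  T ^ (Int.fract s + k - 1) / Real.Gamma (Int.fract s + k) * (1 / Real.Gamma ((⌊s⌋₊ : ℝ) - k + 1))

theorem integral_scaled_kernel {s T ρ : ℝ} (hs : 0 < s) (hT : 0 < T) (hρ : 0 < ρ) :
    Real.sin (Real.pi * Int.fract s) / Real.pi *
        (∫ τ in Ioo 0 ρ, (τ / T) ^ (-Int.fract s) / (τ / T + 1) * (ρ - τ) ^ (s - 1)) =
      T * ((T + ρ) ^ (s - 1) - Real.Gamma s *
        ∑ k ∈ Finset.Icc 1 ⌊s⌋₊, sumCoeff s T k * ρ ^ ((⌊s⌋₊ : ℝ) - k)) := by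
  have hfl : (⌊s⌋₊ : ℝ) + Int.fract s = s := by
    rw [natCast_floor_eq_intCast_floor hs.le, Int.floor_add_fract]
  have h1 : ∫ τ in Ioo 0 ρ, (τ / T) ^ (-Int.fract s) / (τ / T + 1) * (ρ - τ) ^ (s - 1) =
      T * (T ^ (s - 1) * ∫ y in Ioo 0 (ρ / T),
        y ^ (-Int.fract s) / (y + 1) * (ρ / T - y) ^ (s - 1)) := by
    rw [← integral_const_mul, ← integral_Ioc_eq_integral_Ioo, ← integral_Ioc_eq_integral_Ioo,
      ← intervalIntegral.integral_of_le hρ.le, ← intervalIntegral.integral_of_le (by positivity)]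
    have h2 := intervalIntegral.integral_comp_div (a := 0) (b := ρ)
      (fun y => T ^ (s - 1) * (y ^ (-Int.fract s) / (y + 1) * (ρ / T - y) ^ (s - 1))) hT.ne'
    rw [zero_div, smul_eq_mul] at h2
    rw [← h2]
    refine intervalIntegral.integral_congr fun τ hτ => ?_
    rw [uIcc_of_le hρ.le] at hτ
    have h3 : (ρ - τ) ^ (s - 1) = T ^ (s - 1) * (ρ / T - τ / T) ^ (s - 1) := by
      rw [← sub_div, ← Real.mul_rpow hT.le (div_nonneg (sub_nonneg.2 hτ.2) hT.le),
        mul_div_cancel₀ _ hT.ne']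
    rw [h3]
    ring
  have h4 := one_add_rpow_eq hs (div_pos hρ hT)
  have h5 : (T + ρ) ^ (s - 1) = T ^ (s - 1) * (1 + ρ / T) ^ (s - 1) := by
    rw [← Real.mul_rpow hT.le (by positivity)]
    congr 1
    field_simp
  have h6 : Real.Gamma s * ∑ k ∈ Finset.Icc 1 ⌊s⌋₊, sumCoeff s T k * ρ ^ ((⌊s⌋₊ : ℝ) - k) =
      T ^ (s - 1) * ∑ k ∈ Finset.Icc 1 ⌊s⌋₊, Real.Gamma s / (Real.Gamma (Int.fract s + k) *
        Real.Gamma ((⌊s⌋₊ : ℝ) - k + 1)) * (ρ / T) ^ ((⌊s⌋₊ : ℝ) - k) := by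
    rw [Finset.mul_sum, Finset.mul_sum]
    refine Finset.sum_congr rfl fun k _ => ?_
    have h7 : T ^ (s - 1) = T ^ (Int.fract s + k - 1) * T ^ ((⌊s⌋₊ : ℝ) - k) := by
      rw [← Real.rpow_add hT]
      congr 1
      linarith
    have h8 : T ^ ((⌊s⌋₊ : ℝ) - k) ≠ 0 := (Real.rpow_pos_of_pos hT _).ne'
    rw [h7, Real.div_rpow hρ.le hT.le, sumCoeff]
    field_simp
  rw [h1, h5, h6, ← h4]
  ring

variable {X : Type*} [NormedAddCommGroup X] [NormedSpace ℂ X]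

theorem ae_comp_sub_left_of_leftLine {t₀ t : ℝ} (ht : t ≤ t₀) {P : ℝ → Prop}
    (h : ∀ᵐ x ∂leftLine t₀, P x) : ∀ᵐ τ ∂volume.restrict (Ioi (0 : ℝ)), P (t - τ) := by
  rw [ae_restrict_iff' measurableSet_Iio] at h
  rw [ae_restrict_iff' measurableSet_Ioi]
  filter_upwards [(Measure.measurePreserving_sub_left volume t).quasiMeasurePreserving.ae h]
    with τ hτ h0
  exact hτ (lt_of_lt_of_le (sub_lt_self t h0) ht)

theorem fracInt_congr_ae {S : ℝ → X →L[ℂ] X} {t₀ t r : ℝ} (hr : r ≠ 0) (ht : t ≤ t₀)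
    {f f' : ℝ → X} (h : f =ᵐ[leftLine t₀] f') : fracInt S r f t = fracInt S r f' t := by
  rw [fracInt, fracInt, if_neg hr, if_neg hr]
  congr 1
  refine integral_congr_ae ?_
  filter_upwards [ae_comp_sub_left_of_leftLine ht h] with τ hτ
  rw [hτ]

theorem FracIntConvergesAt.congr_ae {S : ℝ → X →L[ℂ] X} {t₀ t r : ℝ} (ht : t ≤ t₀)
    {f f' : ℝ → X} (hf : FracIntConvergesAt S r f t) (h : f =ᵐ[leftLine t₀] f') :
    FracIntConvergesAt S r f' t := by
  refine hf.imp_right fun hf => Integrable.congr hf ?_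
  filter_upwards [ae_comp_sub_left_of_leftLine ht h] with τ hτ
  rw [hτ]

theorem tendsto_semigroup_apply {S : ℝ → X →L[ℂ] X} (hS : IsMeasurableSemigroup S) {M w : ℝ}
    (hM : ∀ t : ℝ, 0 ≤ t → ‖S t‖ ≤ M * Real.exp (-w * t)) (hw : 0 < w) {α : Type*} {l : Filter α}
    {u : α → ℝ} {v : α → X} {r : ℝ} {x : X} (hr : 0 < r) (hu : Tendsto u l (𝓝 r))
    (hv : Tendsto v l (𝓝 x)) : Tendsto (fun a => S (u a) (v a)) l (𝓝 (S r x)) := by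
  have hM0 := nonneg_of_stable hM
  have h1 : Tendsto (fun a => S (u a) x) l (𝓝 (S r x)) :=
    ((hS.continuousOn_apply x).continuousAt (Ioi_mem_nhds hr)).tendsto.comp hu
  have h2 : Tendsto (fun a => S (u a) (v a - x)) l (𝓝 0) := by
    have h3 : Tendsto (fun a => M * ‖v a - x‖) l (𝓝 0) := by
      simpa using (tendsto_iff_norm_sub_tendsto_zero.1 hv).const_mul M
    refine squeeze_zero_norm' ?_ h3
    filter_upwards [hu.eventually (Ioi_mem_nhds hr)] with a ha
    refine (S (u a)).le_of_opNorm_le ((hM _ (le_of_lt ha)).trans ?_) _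
    refine mul_le_of_le_one_right hM0 (Real.exp_le_one_iff.2 ?_)
    have : 0 < u a := ha
    nlinarith
  refine (by simpa using h2.add h1 : Tendsto (fun a => S (u a) (v a - x) + S (u a) x) l _).congr
    fun a => ?_
  rw [map_sub, sub_add_cancel]

theorem continuousOn_semigroup_apply {S : ℝ → X →L[ℂ] X} (hS : IsMeasurableSemigroup S) {M w : ℝ}
    (hM : ∀ t : ℝ, 0 ≤ t → ‖S t‖ ≤ M * Real.exp (-w * t)) (hw : 0 < w)
    {u : ℝ → ℝ} {v : ℝ → X} {s : Set ℝ} (hu0 : ∀ a ∈ s, 0 < u a) (hu : ContinuousOn u s)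
    (hv : ContinuousOn v s) : ContinuousOn (fun a => S (u a) (v a)) s :=
  fun a ha => tendsto_semigroup_apply hS hM hw (hu0 a ha) (hu a ha) (hv a ha)

theorem integrableOn_integralTerm {S : ℝ → X →L[ℂ] X} (hS : IsMeasurableSemigroup S) {M w : ℝ}
    (hM : ∀ t : ℝ, 0 ≤ t → ‖S t‖ ≤ M * Real.exp (-w * t)) (hw : 0 < w) {a T t₀ C : ℝ}
    (ha : a < 1) (hT : 0 < T) {h : ℝ → X} (hc : Continuous h) (hC : ∀ t, ‖h t‖ ≤ C) :
    IntegrableOn (fun τ : ℝ => (τ ^ (-a) / (τ + 1)) • S (T * (τ + 1)) (h (t₀ - T * τ)))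
      (Ioi 0) := by
  have hM0 := nonneg_of_stable hM
  have hI := (integrableOn_rpow_mul_exp_neg_mul_rpow (p := 1) (s := -a) (b := w * T)
    (by linarith) one_pos (by positivity)).const_mul (M * C)
  refine Integrable.mono' hI ?_ ?_
  · have hm : Measurable fun τ : ℝ => τ ^ (-a) / (τ + 1) := by fun_prop
    refine hm.aestronglyMeasurable.smul ?_
    refine ContinuousOn.aestronglyMeasurable ?_ measurableSet_Ioi
    refine continuousOn_semigroup_apply hS hM hw (fun τ hτ => ?_) (by fun_prop) (by fun_prop)
    have : (0 : ℝ) < τ := hτ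
    positivity
  · filter_upwards [ae_restrict_mem measurableSet_Ioi] with τ hτ
    have hτ' : (0 : ℝ) < τ := hτ
    have hC0 : 0 ≤ C := (norm_nonneg _).trans (hC 0)
    calc _ ≤ M * (|τ ^ (-a) / (τ + 1)| * Real.exp (-w * (T * (τ + 1))) * ‖h (t₀ - T * τ)‖) :=
          norm_smul_apply_le hM (by positivity) _ _
      _ ≤ M * (τ ^ (-a) * Real.exp (-(w * T) * τ ^ (1 : ℝ)) * C) := by
          rw [abs_of_nonneg (by positivity)]
          have h1 : τ ^ (-a) / (τ + 1) ≤ τ ^ (-a) := div_le_self (by positivity) (by linarith)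
          have h2 : Real.exp (-w * (T * (τ + 1))) ≤ Real.exp (-(w * T) * τ ^ (1 : ℝ)) := by
            rw [Real.rpow_one]
            refine Real.exp_le_exp.2 ?_
            nlinarith [mul_pos hw hT]
          have h3 := hC (t₀ - T * τ)
          gcongr
      _ = _ := by ring

theorem fracInt_eq_integral_shift {S : ℝ → X →L[ℂ] X} {s t₀ T : ℝ} (hs : 0 < s) (hT : 0 < T)
    {F : ℝ → X} (hF0 : ∀ t, t₀ < t → F t = 0) :
    fracInt S s F (t₀ + T) =
      (1 / Real.Gamma s) • ∫ ρ in Ioi 0, (T + ρ) ^ (s - 1) • S (T + ρ) (F (t₀ - ρ)) := by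
  rw [fracInt, if_neg hs.ne']
  congr 1
  rw [← integral_indicator measurableSet_Ioi, ← integral_indicator measurableSet_Ioi,
    ← integral_add_left_eq_self _ T]
  -- `F t₀` is not assumed to vanish, so `ρ = 0` is discarded as a null set.
  have hne : ∀ᵐ ρ : ℝ, ρ ≠ 0 := by simp [ae_iff, measure_singleton]
  refine integral_congr_ae ?_
  filter_upwards [hne] with ρ hρ
  by_cases h : 0 < ρ
  · rw [indicator_of_mem (show ρ ∈ Ioi 0 from h),
      indicator_of_mem (show T + ρ ∈ Ioi 0 from add_pos hT h),
      show t₀ + T - (T + ρ) = t₀ - ρ by ring]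
  · have hlt : ρ < 0 := lt_of_le_of_ne (not_lt.1 h) hρ
    rw [indicator_of_notMem (show ρ ∉ Ioi 0 from h)]
    refine indicator_apply_eq_zero.2 fun _ => ?_
    rw [hF0 _ (by linarith), map_zero, smul_zero]

end

/-! ### The formula to the right of the initial time -/

section

variable {X : Type*} [NormedAddCommGroup X] [NormedSpace ℂ X] [CompleteSpace X]

/-- All terms are brought to the form of a kernel integrated against `v`. The finite sum contributes
powers of `ρ`, the left side a power of `T + ρ`, and the integral term their difference, by the
scaled scalar identity. -/
theorem fracInt_right_eq {S : ℝ → X →L[ℂ] X} (hS : IsMeasurableSemigroup S) {M w : ℝ}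
    (hM : ∀ t : ℝ, 0 ≤ t → ‖S t‖ ≤ M * Real.exp (-w * t)) (hw : 0 < w)
    {p : ENNReal} (hp : 1 ≤ p) {s : ℝ}
    (hs : (p = 1 ∧ 1 ≤ s) ∨ (p ≠ 1 ∧ p⁻¹.toReal < s)) {F : ℝ → X} (hF : MemLp F p volume)
    {t₀ T : ℝ} (hT : 0 < T) (hF0 : ∀ t, t₀ < t → F t = 0) :
    fracInt S s F (t₀ + T) =
      (Real.sin (Real.pi * Int.fract s) / Real.pi) •
        (∫ τ in Ioi (0 : ℝ), (τ ^ (-Int.fract s) / (τ + 1)) •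
          S (T * (τ + 1)) (fracInt S s F (t₀ - T * τ))) +
      ∑ k ∈ Finset.Icc 1 ⌊s⌋₊, (T ^ (Int.fract s + k - 1) / Real.Gamma (Int.fract s + k)) •
        S T (fracInt S ((⌊s⌋₊ : ℝ) - k + 1) F t₀) := by
  have hs0 := order_pos hs
  have hGs := Real.Gamma_pos_of_pos hs0
  have hFt : AEStronglyMeasurable (fun τ => F (t₀ - τ)) (volume.restrict (Ioi 0)) :=
    (aestronglyMeasurable_comp_sub_left hF.1 t₀).restrict
  let E : ℝ → ℝ := fun ρ => Real.exp (-w * ρ) * ‖F (t₀ - ρ)‖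
  let v : ℝ → X := fun ρ => S (T + ρ) (F (t₀ - ρ))
  have hv : ∀ φ : ℝ → ℝ, Measurable φ → IntegrableOn (fun ρ => φ ρ * E ρ) (Ioi 0) →
      IntegrableOn (fun ρ => φ ρ • S ρ (F (t₀ - ρ))) (Ioi 0) := by
    intro φ hφ h
    refine integrableOn_smul_apply hS hM hφ hFt (IntegrableOn.congr_fun h.norm (fun ρ _ => ?_)
      measurableSet_Ioi)
    rw [norm_mul, Real.norm_eq_abs, Real.norm_of_nonneg (by positivity), mul_assoc]
  have hST : ∀ φ : ℝ → ℝ, ∀ ρ ∈ Ioi (0 : ℝ), φ ρ • v ρ = S T (φ ρ • S ρ (F (t₀ - ρ))) := by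
    intro φ ρ hρ
    rw [ContinuousLinearMap.map_smul_of_tower]
    simp only [v]
    rw [hS.map_add T ρ hT.le (le_of_lt hρ)]
    rfl
  have hvT : ∀ φ : ℝ → ℝ, Measurable φ → IntegrableOn (fun ρ => φ ρ * E ρ) (Ioi 0) →
      IntegrableOn (fun ρ => φ ρ • v ρ) (Ioi 0) := by
    intro φ hφ h
    exact IntegrableOn.congr_fun ((S T).integrable_comp (hv φ hφ h))
      (fun ρ hρ => (hST φ ρ hρ).symm) measurableSet_Ioi
  have hI1 : IntegrableOn (fun ρ => (T + ρ) ^ (s - 1) * E ρ) (Ioi 0) := by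
    obtain ⟨C, hC⟩ := exists_gammaKernel_bound hp hw hs hF
    have h1 := (((integrable_indicator_iff measurableSet_Ioi).2
      (hC (t₀ + T)).1).comp_add_left T).const_mul (Real.exp (w * T))
    refine IntegrableOn.congr_fun h1.integrableOn (fun ρ hρ => ?_) measurableSet_Ioi
    have hρ' : (0 : ℝ) < ρ := hρ
    simp only [E]
    rw [indicator_of_mem (show T + ρ ∈ Ioi 0 from add_pos hT hρ'), gammaKernel,
      show t₀ + T - (T + ρ) = t₀ - ρ by ring,
      show Real.exp (-w * ρ) = Real.exp (w * T) * Real.exp (-w * (T + ρ)) by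
        rw [← Real.exp_add]
        ring_nf]
    ring
  have hI2 : ∀ k ∈ Finset.Icc 1 ⌊s⌋₊,
      IntegrableOn (fun ρ => ρ ^ ((⌊s⌋₊ : ℝ) - k) * E ρ) (Ioi 0) := by
    intro k hk
    have hk' : (k : ℝ) ≤ ⌊s⌋₊ := by exact_mod_cast (Finset.mem_Icc.1 hk).2
    obtain ⟨C, hC⟩ := exists_gammaKernel_bound hp hw
      (order_of_one_le hp (s := (⌊s⌋₊ : ℝ) - k + 1) (by linarith)) hF
    refine IntegrableOn.congr_fun (hC t₀).1 (fun ρ _ => ?_) measurableSet_Ioi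
    simp only [gammaKernel, E, add_sub_cancel_right]
    ring
  let Φ : ℝ → ℝ := fun ρ => 1 / Real.Gamma s * (T + ρ) ^ (s - 1) -
    ∑ k ∈ Finset.Icc 1 ⌊s⌋₊, sumCoeff s T k * ρ ^ ((⌊s⌋₊ : ℝ) - k)
  have hΦm : Measurable Φ := by
    simp only [Φ]
    fun_prop
  have hIΦ : IntegrableOn (fun ρ => Φ ρ * E ρ) (Ioi 0) := by
    have h1 := (hI1.const_mul (1 / Real.Gamma s)).sub (integrable_finsetSum _
      fun k hk => (hI2 k hk).const_mul (sumCoeff s T k))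
    refine IntegrableOn.congr_fun h1 (fun ρ _ => ?_) measurableSet_Ioi
    simp only [Φ, Pi.sub_apply]
    rw [sub_mul, Finset.sum_mul]
    simp only [mul_assoc]
  have hkey : ∀ ρ, 0 < ρ → Real.sin (Real.pi * Int.fract s) / Real.pi *
      (∫ τ in Ioo 0 ρ, (τ / T) ^ (-Int.fract s) / (τ / T + 1) * (ρ - τ) ^ (s - 1)) =
      T * Real.Gamma s * Φ ρ := by
    intro ρ hρ
    rw [integral_scaled_kernel hs0 hT hρ]
    simp only [Φ]
    field_simp
  have hfirst : (Real.sin (Real.pi * Int.fract s) / Real.pi) •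
        (∫ τ in Ioi (0 : ℝ), (τ ^ (-Int.fract s) / (τ + 1)) •
          S (T * (τ + 1)) (fracInt S s F (t₀ - T * τ))) = ∫ ρ in Ioi 0, Φ ρ • v ρ := by
    -- For integer `s` the sine vanishes and cannot be divided by; there the remainder `Φ` is zero
    -- on `(0, ∞)`.
    rcases eq_or_lt_of_le (Int.fract_nonneg s) with ha | ha
    · have hz : ∀ ρ ∈ Ioi (0 : ℝ), Φ ρ • v ρ = 0 := by
        intro ρ hρ
        have h1 := hkey ρ hρ
        rw [← ha, mul_zero, Real.sin_zero, zero_div, zero_mul] at h1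
        have h2 : Φ ρ = 0 := by
          have := (mul_pos hT hGs).ne'
          rcases mul_eq_zero.1 h1.symm with h | h
          · exact absurd h this
          · exact h
        rw [h2, zero_smul]
      rw [setIntegral_congr_fun measurableSet_Ioi hz, integral_zero, ← ha, mul_zero,
        Real.sin_zero, zero_div, zero_smul]
    · have hsin : 0 < Real.sin (Real.pi * Int.fract s) :=
        Real.sin_pos_of_pos_of_lt_pi (by positivity)
          (by nlinarith [Real.pi_pos, Int.fract_lt_one s])
      have hK : ∀ ρ, 0 < ρ →
          ∫ τ in Ioo 0 ρ, (τ / T) ^ (-Int.fract s) / (τ / T + 1) * (ρ - τ) ^ (s - 1) =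
          (Real.pi / Real.sin (Real.pi * Int.fract s) * (T * Real.Gamma s)) * Φ ρ := by
        intro ρ hρ
        have h1 : Real.pi / Real.sin (Real.pi * Int.fract s) *
            (Real.sin (Real.pi * Int.fract s) / Real.pi) = 1 := by
          field_simp
        rw [mul_assoc, ← hkey ρ hρ, ← mul_assoc, h1, one_mul]
      have hkI : ∀ ρ, 0 < ρ → IntegrableOn
          (fun τ => (τ / T) ^ (-Int.fract s) / (τ / T + 1) * (ρ - τ) ^ (s - 1)) (Ioo 0 ρ) := by
        intro ρ hρ
        have h1 := (integrableOn_rpow_mul_sub_rpow (a := 1 - Int.fract s)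
          (by linarith [Int.fract_lt_one s]) hs0 hρ).const_mul (T ^ (-Int.fract s))⁻¹
        refine Integrable.mono' h1 (Measurable.aestronglyMeasurable (by fun_prop)) ?_
        filter_upwards [ae_restrict_mem measurableSet_Ioo] with τ hτ
        have h2 : 0 < τ := hτ.1
        have h3 : 0 < ρ - τ := sub_pos.2 hτ.2
        rw [Real.norm_of_nonneg (by positivity), show 1 - Int.fract s - 1 = -Int.fract s by ring,
          Real.div_rpow h2.le hT.le, ← mul_assoc, inv_mul_eq_div]
        have h4 : 0 < τ / T := by positivity
        exact mul_le_mul_of_nonneg_right (div_le_self (by positivity) (by linarith))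
          (by positivity)
      have hmain := (integral_smul_apply_integral hS hM hw hT.le (F := F) (t := t₀)
        (k₁ := fun τ => (τ / T) ^ (-Int.fract s) / (τ / T + 1)) (k₂ := fun τ => τ ^ (s - 1))
        (by fun_prop) (by fun_prop)
        (hΦm.const_mul (Real.pi / Real.sin (Real.pi * Int.fract s) * (T * Real.Gamma s)))
        (fun τ hτ => by positivity) (fun τ hτ => by positivity) hkI hK hF.1 (by
          refine IntegrableOn.congr_fun (hIΦ.const_mul
            (Real.pi / Real.sin (Real.pi * Int.fract s) * (T * Real.Gamma s)))
            (fun ρ _ => ?_) measurableSet_Ioi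
          simp only [E]
          ring)).2
      have hscale := integral_comp_mul_left_Ioi (fun τ =>
        ((τ / T) ^ (-Int.fract s) / (τ / T + 1)) • S (T + τ) (fracInt S s F (t₀ - τ))) 0 hT
      rw [mul_zero] at hscale
      have hL : ∫ τ in Ioi (0 : ℝ), (τ ^ (-Int.fract s) / (τ + 1)) •
          S (T * (τ + 1)) (fracInt S s F (t₀ - T * τ)) = ∫ τ in Ioi (0 : ℝ),
          ((T * τ / T) ^ (-Int.fract s) / (T * τ / T + 1)) •
            S (T + T * τ) (fracInt S s F (t₀ - T * τ)) := by
        refine integral_congr_ae (Eventually.of_forall fun τ => ?_)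
        simp only
        rw [mul_div_cancel_left₀ _ hT.ne', show T * (τ + 1) = T + T * τ by ring]
      have hR : ∫ τ in Ioi (0 : ℝ), ((τ / T) ^ (-Int.fract s) / (τ / T + 1)) •
            S (T + τ) (fracInt S s F (t₀ - τ)) = (1 / Real.Gamma s) •
          ∫ τ in Ioi (0 : ℝ), ((τ / T) ^ (-Int.fract s) / (τ / T + 1)) •
            S (T + τ) (∫ σ in Ioi 0, σ ^ (s - 1) • S σ (F (t₀ - τ - σ))) := by
        rw [← integral_smul]
        refine integral_congr_ae (Eventually.of_forall fun τ => ?_)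
        simp only
        rw [fracInt, if_neg hs0.ne', ContinuousLinearMap.map_smul_of_tower, smul_comm]
      rw [hL, hscale, hR, hmain, smul_smul, smul_smul, ← integral_smul]
      refine integral_congr_ae (Eventually.of_forall fun ρ => ?_)
      simp only [smul_smul]
      congr 1
      field_simp
  have hsum : ∀ k ∈ Finset.Icc 1 ⌊s⌋₊,
      (T ^ (Int.fract s + k - 1) / Real.Gamma (Int.fract s + k)) •
        S T (fracInt S ((⌊s⌋₊ : ℝ) - k + 1) F t₀) =
      ∫ ρ in Ioi 0, (sumCoeff s T k * ρ ^ ((⌊s⌋₊ : ℝ) - k)) • v ρ := by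
    intro k hk
    have hk' : (k : ℝ) ≤ ⌊s⌋₊ := by exact_mod_cast (Finset.mem_Icc.1 hk).2
    rw [fracInt, if_neg (by linarith), ContinuousLinearMap.map_smul_of_tower, smul_smul,
      ← ContinuousLinearMap.integral_comp_comm, ← integral_smul]
    · refine setIntegral_congr_fun measurableSet_Ioi fun ρ hρ => ?_
      simp only [add_sub_cancel_right]
      rw [← hST (fun ρ => ρ ^ ((⌊s⌋₊ : ℝ) - k)) ρ hρ, smul_smul, sumCoeff]
    · simp only [add_sub_cancel_right]
      exact hv _ (by fun_prop) (hI2 k hk)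
  have hΦI := hvT _ hΦm hIΦ
  have hsI : ∀ k ∈ Finset.Icc 1 ⌊s⌋₊,
      IntegrableOn (fun ρ => (sumCoeff s T k * ρ ^ ((⌊s⌋₊ : ℝ) - k)) • v ρ) (Ioi 0) := by
    intro k hk
    refine hvT (fun ρ => sumCoeff s T k * ρ ^ ((⌊s⌋₊ : ℝ) - k)) (by fun_prop) ?_
    refine IntegrableOn.congr_fun ((hI2 k hk).const_mul (sumCoeff s T k)) (fun ρ _ => ?_)
      measurableSet_Ioi
    simp only [mul_assoc]
  rw [hfirst, Finset.sum_congr rfl hsum, ← integral_finsetSum _ hsI,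
    ← integral_add hΦI (integrable_finsetSum _ hsI), fracInt_eq_integral_shift hs0 hT hF0,
    ← integral_smul]
  refine integral_congr_ae (Eventually.of_forall fun ρ => ?_)
  simp only [Φ, v]
  rw [← Finset.sum_smul, ← add_smul, sub_add_cancel, smul_smul]

theorem memLp_indicator_Iio {E : Type*} [NormedAddCommGroup E] {p : ENNReal} {t₀ : ℝ}
    {f : ℝ → E} (hf : MemLp f p (leftLine t₀)) :
    MemLp ((Iio t₀).indicator f) p volume :=
  (memLp_indicator_iff_restrict measurableSet_Iio).2 hf

theorem indicator_Iio_ae_eq {E : Type*} [Zero E] (t₀ : ℝ) (f : ℝ → E) :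
    (Iio t₀).indicator f =ᵐ[leftLine t₀] f := by
  filter_upwards [ae_restrict_mem measurableSet_Iio] with t ht
  rw [indicator_of_mem ht]

theorem indicator_Iic_ae_eq {E : Type*} [Zero E] (t₀ t : ℝ) (f : ℝ → E) :
    (Iio t₀).indicator f =ᵐ[leftLine t] (Iic t₀).indicator f :=
  ae_restrict_of_ae (indicator_ae_eq_of_ae_eq_set Iio_ae_eq_Iic)

theorem fracInt_extension {S : ℝ → X →L[ℂ] X} (hS : IsMeasurableSemigroup S) {M w : ℝ}
    (hM : ∀ t : ℝ, 0 ≤ t → ‖S t‖ ≤ M * Real.exp (-w * t)) (hw : 0 < w)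
    {p : ENNReal} (hp : 1 ≤ p) {t₀ s : ℝ}
    (hs : (p = 1 ∧ 1 ≤ s) ∨ (p ≠ 1 ∧ p⁻¹.toReal < s)) {f : ℝ → X}
    (hf : MemLp f p (leftLine t₀)) :
    (∀ r ≤ t₀, FracIntConvergesAt S s f r) ∧
      (∀ k ∈ Finset.Icc 1 ⌊s⌋₊, FracIntConvergesAt S ((⌊s⌋₊ : ℝ) - k + 1) f t₀) ∧
      ∀ t : ℝ, t₀ < t →
        FracIntConvergesAt S s ((Iic t₀).indicator f) t ∧
        IntegrableOn (fun τ : ℝ => (τ ^ (-Int.fract s) / (τ + 1)) •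
          S ((t - t₀) * (τ + 1)) (fracInt S s f (t₀ - (t - t₀) * τ))) (Ioi 0) ∧
        fracInt S s ((Iic t₀).indicator f) t =
          (Real.sin (Real.pi * Int.fract s) / Real.pi) •
            (∫ τ in Ioi (0 : ℝ), (τ ^ (-Int.fract s) / (τ + 1)) •
              S ((t - t₀) * (τ + 1)) (fracInt S s f (t₀ - (t - t₀) * τ))) +
          ∑ k ∈ Finset.Icc 1 ⌊s⌋₊,
            ((t - t₀) ^ (Int.fract s + k - 1) / Real.Gamma (Int.fract s + k)) •
              S (t - t₀) (fracInt S ((⌊s⌋₊ : ℝ) - k + 1) f t₀) := by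
  have hs0 := order_pos hs
  have hF := memLp_indicator_Iio hf
  set F := (Iio t₀).indicator f with hFdef
  have hFf : F =ᵐ[leftLine t₀] f := indicator_Iio_ae_eq t₀ f
  obtain ⟨C, hC⟩ := exists_gammaKernel_bound hp hw hs hF
  have hconv : ∀ r, FracIntConvergesAt S s F r := fun r =>
    fracIntConvergesAt_of_integrableOn hS hM hF.1 (hC r).1
  have hk : ∀ k ∈ Finset.Icc 1 ⌊s⌋₊, (1 : ℝ) ≤ (⌊s⌋₊ : ℝ) - k + 1 := by
    intro k hk
    have : (k : ℝ) ≤ ⌊s⌋₊ := by exact_mod_cast (Finset.mem_Icc.1 hk).2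
    linarith
  refine ⟨fun r hr => (hconv r).congr_ae hr hFf, fun k hk' => ?_, fun t ht => ?_⟩
  · obtain ⟨C', hC'⟩ := exists_gammaKernel_bound hp hw (order_of_one_le hp (hk k hk')) hF
    exact (fracIntConvergesAt_of_integrableOn hS hM hF.1 (hC' t₀).1).congr_ae le_rfl hFf
  · have hT : 0 < t - t₀ := sub_pos.2 ht
    have hFr : ∀ τ ∈ Ioi (0 : ℝ), (τ ^ (-Int.fract s) / (τ + 1)) •
          S ((t - t₀) * (τ + 1)) (fracInt S s F (t₀ - (t - t₀) * τ)) =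
        (τ ^ (-Int.fract s) / (τ + 1)) •
          S ((t - t₀) * (τ + 1)) (fracInt S s f (t₀ - (t - t₀) * τ)) := by
      intro τ hτ
      have hτ' : (0 : ℝ) < τ := hτ
      rw [fracInt_congr_ae hs0.ne' (sub_le_self _ (by positivity)) hFf]
    refine ⟨(hconv t).congr_ae le_rfl (indicator_Iic_ae_eq t₀ t f), ?_, ?_⟩
    · obtain ⟨B, hB⟩ := exists_norm_fracInt_le hM hw hp hs hF
      exact IntegrableOn.congr_fun (integrableOn_integralTerm hS hM hw (Int.fract_lt_one s) hT
        (continuous_fracInt hS hM hw hp hs hF) hB) hFr measurableSet_Ioi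
    · rw [← fracInt_congr_ae hs0.ne' le_rfl (indicator_Iic_ae_eq t₀ t f),
        ← setIntegral_congr_fun measurableSet_Ioi hFr]
      have h1 := fracInt_right_eq hS hM hw hp hs hF hT (t₀ := t₀)
        (fun r hr => indicator_of_notMem (by simpa using hr.le) f)
      rw [add_sub_cancel] at h1
      rw [h1]
      congr 1
      refine Finset.sum_congr rfl fun k hk' => ?_
      rw [fracInt_congr_ae (by linarith [hk k hk']) le_rfl hFf]

end

/-! ### Injectivity of the integral of order one -/

section

theorem eqOn_Iic_of_ae_eq {E : Type*} [TopologicalSpace E] [T2Space E] {t₀ : ℝ} {f g : ℝ → E}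
    (hf : ContinuousOn f (Iic t₀)) (hg : ContinuousOn g (Iic t₀)) (h : f =ᵐ[leftLine t₀] g) :
    EqOn f g (Iic t₀) := by
  have h1 : EqOn f g (Iio t₀) := Measure.eqOn_open_of_ae_eq h isOpen_Iio
    (hf.mono Iio_subset_Iic_self) (hg.mono Iio_subset_Iic_self)
  exact h1.of_subset_closure hf hg Iio_subset_Iic_self (by rw [closure_Iio])

theorem ae_eq_zero_of_forall_intervalIntegral_eq_zero {E : Type*} [NormedAddCommGroup E]
    [NormedSpace ℝ E] [CompleteSpace E] {u : ℝ → E} (hu : IntegrableOn u (Ioi 0))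
    (h : ∀ T, 0 < T → ∫ τ in (0 : ℝ)..T, u τ = 0) : ∀ᵐ τ ∂volume.restrict (Ioi 0), u τ = 0 := by
  have hU : Integrable ((Ioi 0).indicator u) := (integrable_indicator_iff measurableSet_Ioi).2 hu
  have hz : (fun x => ∫ t in (0 : ℝ)..x, (Ioi 0).indicator u t) = fun _ => 0 := by
    funext x
    rcases le_or_gt x 0 with hx | hx
    · rw [intervalIntegral.integral_symm, intervalIntegral.integral_of_le hx,
        setIntegral_congr_fun (g := fun _ => 0) measurableSet_Ioc, integral_zero, neg_zero]
      intro t ht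
      exact indicator_of_notMem (by simpa using ht.2) u
    · rw [← h x hx, intervalIntegral.integral_of_le hx.le, intervalIntegral.integral_of_le hx.le]
      exact setIntegral_congr_fun measurableSet_Ioc fun t ht =>
        indicator_of_mem (show t ∈ Ioi 0 from ht.1) u
  rw [ae_restrict_iff' measurableSet_Ioi]
  filter_upwards [LocallyIntegrable.ae_hasDerivAt_integral hU.locallyIntegrable] with τ hτ hτ0
  have h1 := hτ 0
  rw [hz, indicator_of_mem hτ0] at h1
  exact h1.unique (hasDerivAt_const τ 0)

variable {X : Type*} [NormedAddCommGroup X] [NormedSpace ℂ X]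

/-- The hypothesis makes `(0, y)` satisfy the integral criterion for the graph, and `A` is
single-valued. -/
theorem IsNegGenerator.eq_zero_of_forall_apply_eq_zero {S : ℝ → X →L[ℂ] X} {A : X →ₗ.[ℂ] X}
    (hA : IsNegGenerator S A) {y : X} (h : ∀ r, 0 < r → S r y = 0) : y = 0 := by
  refine A.graph_fst_eq_zero_snd (x := 0) ((hA 0 y).2 fun t ht => ?_) rfl
  rw [intervalIntegral.integral_of_le ht, setIntegral_congr_fun (g := fun _ => 0)
    measurableSet_Ioc fun r hr => h r hr.1]
  simp

theorem fracInt_one (S : ℝ → X →L[ℂ] X) (u : ℝ → X) (t : ℝ) :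
    fracInt S 1 u t = ∫ τ in Ioi 0, S τ (u (t - τ)) := by
  simp [fracInt]

theorem integrableOn_apply_of_memLp {S : ℝ → X →L[ℂ] X} (hS : IsMeasurableSemigroup S) {M w : ℝ}
    (hM : ∀ t : ℝ, 0 ≤ t → ‖S t‖ ≤ M * Real.exp (-w * t)) (hw : 0 < w) {p : ENNReal} (hp : 1 ≤ p)
    {F : ℝ → X} (hF : MemLp F p volume) (t : ℝ) :
    IntegrableOn (fun τ => S τ (F (t - τ))) (Ioi 0) := by
  obtain ⟨C, hC⟩ := exists_gammaKernel_bound hp hw (order_of_one_le hp le_rfl) hF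
  rcases fracIntConvergesAt_of_integrableOn hS hM hF.1 (hC t).1 with h1 | h1
  · exact absurd h1 one_ne_zero
  · simpa using h1

variable [CompleteSpace X]

/-- The tail of the integral beyond `T` is `S T` applied to the integral at time `t - T`, hence
zero. So the integrals over `(0, T)` vanish, and differentiating in `T` shows that `S (q - t)` kills
`H t` for almost every `t < q`. Only integrability is asked of `H`, so that bounded functions
outside `L^p` are covered. -/
theorem ae_eq_zero_of_forall_integral_eq_zero {S : ℝ → X →L[ℂ] X} {A : X →ₗ.[ℂ] X}
    (hS : IsMeasurableSemigroup S) (hA : IsNegGenerator S A) {t₀ : ℝ} {H : ℝ → X}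
    (hI : ∀ t, IntegrableOn (fun τ => S τ (H (t - τ))) (Ioi 0))
    (hz : ∀ t ≤ t₀, ∫ τ in Ioi 0, S τ (H (t - τ)) = 0) : ∀ᵐ t ∂leftLine t₀, H t = 0 := by
  have hint : ∀ q ≤ t₀, ∀ T, 0 < T → ∫ τ in (0 : ℝ)..T, S τ (H (q - τ)) = 0 := by
    intro q hq T hT
    have h1 := setIntegral_union (Ioc_disjoint_Ioi_same (a := (0 : ℝ)) (b := T)) measurableSet_Ioi
      ((hI q).mono_set Ioc_subset_Ioi_self) ((hI q).mono_set (Ioi_subset_Ioi hT.le))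
    have h2 : ∫ τ in Ioi T, S τ (H (q - τ)) = 0 := by
      rw [← integral_indicator measurableSet_Ioi, ← integral_add_left_eq_self _ T]
      have h3 : (fun ρ => (Ioi T).indicator (fun τ => S τ (H (q - τ))) (T + ρ)) =
          (Ioi 0).indicator fun ρ => S T (S ρ (H (q - T - ρ))) := by
        funext ρ
        by_cases hρ : 0 < ρ
        · rw [indicator_of_mem (show ρ ∈ Ioi 0 from hρ),
            indicator_of_mem (show T + ρ ∈ Ioi T by simpa using hρ), hS.map_add T ρ hT.le hρ.le,
            sub_sub]
          rfl
        · rw [indicator_of_notMem (show ρ ∉ Ioi 0 from hρ),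
            indicator_of_notMem (show T + ρ ∉ Ioi T by simpa using hρ)]
      rw [h3, integral_indicator measurableSet_Ioi,
        ContinuousLinearMap.integral_comp_comm _ (hI (q - T)), hz _ (by linarith), map_zero]
    rw [Ioc_union_Ioi_eq_Ioi hT.le, hz q hq, h2, add_zero] at h1
    rw [intervalIntegral.integral_of_le hT.le, ← h1]
  have hq : ∀ q : ℚ, (q : ℝ) ≤ t₀ → ∀ᵐ t : ℝ, t < q → S (q - t) (H t) = 0 := by
    intro q hqt
    have h1 := ae_eq_zero_of_forall_intervalIntegral_eq_zero (hI q) (hint q hqt)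
    rw [ae_restrict_iff' measurableSet_Ioi] at h1
    filter_upwards [(Measure.measurePreserving_sub_left volume (q : ℝ)).quasiMeasurePreserving.ae h1]
      with t ht htq
    simpa using ht (sub_pos.2 htq)
  -- Rational times keep the exceptional set null. Any `r > 0` is then reached through a rational
  -- `q` with `0 < q - t < r` by the semigroup law.
  have hq' : ∀ᵐ t : ℝ, ∀ q : ℚ, (q : ℝ) ≤ t₀ → t < q → S (q - t) (H t) = 0 := by
    rw [ae_all_iff]
    intro q
    by_cases hqt : (q : ℝ) ≤ t₀
    · filter_upwards [hq q hqt] with t ht _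
      exact ht
    · exact Eventually.of_forall fun t h1 => absurd h1 hqt
  filter_upwards [ae_restrict_of_ae hq', ae_restrict_mem measurableSet_Iio] with t ht ht0
  refine hA.eq_zero_of_forall_apply_eq_zero fun r hr => ?_
  obtain ⟨q, hq1, hq2⟩ := exists_rat_btwn (lt_min (show t < t₀ from ht0) (lt_add_of_pos_right t hr))
  have h1 := ht q (hq2.le.trans (min_le_left _ _)) hq1
  have h2 : (q : ℝ) < t + r := hq2.trans_le (min_le_right _ _)
  rw [show r = (r - (q - t)) + (q - t) by ring,
    hS.map_add _ _ (by linarith) (by linarith), ContinuousLinearMap.comp_apply, h1, map_zero]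

theorem ae_eq_of_fracInt_one_ae_eq {S : ℝ → X →L[ℂ] X} {A : X →ₗ.[ℂ] X}
    (hS : IsMeasurableSemigroup S) (hA : IsNegGenerator S A) {M w : ℝ}
    (hM : ∀ t : ℝ, 0 ≤ t → ‖S t‖ ≤ M * Real.exp (-w * t)) (hw : 0 < w)
    {p : ENNReal} (hp : 1 ≤ p) {t₀ : ℝ} {f g : ℝ → X} (hf : MemLp f p (leftLine t₀))
    (hg : MemLp g p (leftLine t₀)) (h : fracInt S 1 f =ᵐ[leftLine t₀] fracInt S 1 g) :
    f =ᵐ[leftLine t₀] g := by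
  have hF := memLp_indicator_Iio hf
  have hG := memLp_indicator_Iio hg
  have hFf := indicator_Iio_ae_eq t₀ f
  have hGg := indicator_Iio_ae_eq t₀ g
  have h1 : fracInt S 1 ((Iio t₀).indicator f) =ᵐ[leftLine t₀]
      fracInt S 1 ((Iio t₀).indicator g) := by
    filter_upwards [h, ae_restrict_mem measurableSet_Iio] with t ht ht0
    rw [fracInt_congr_ae one_ne_zero (le_of_lt ht0) hFf, ht,
      fracInt_congr_ae one_ne_zero (le_of_lt ht0) hGg]
  have hcF := continuous_fracInt hS hM hw hp (order_of_one_le hp le_rfl) hF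
  have hcG := continuous_fracInt hS hM hw hp (order_of_one_le hp le_rfl) hG
  have h2 := eqOn_Iic_of_ae_eq hcF.continuousOn hcG.continuousOn h1
  have hIF := integrableOn_apply_of_memLp hS hM hw hp hF
  have hIG := integrableOn_apply_of_memLp hS hM hw hp hG
  have h3 := ae_eq_zero_of_forall_integral_eq_zero hS hA (t₀ := t₀)
    (H := (Iio t₀).indicator f - (Iio t₀).indicator g)
    (fun t => IntegrableOn.congr_fun ((hIF t).sub (hIG t)) (fun τ _ => (map_sub (S τ) _ _).symm)
      measurableSet_Ioi) (fun t ht => by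
      simp only [Pi.sub_apply, map_sub]
      rw [integral_sub (hIF t) (hIG t), ← fracInt_one, ← fracInt_one, h2 ht, sub_self])
  filter_upwards [h3, hFf, hGg] with t ht e1 e2
  rw [← e1, ← e2]
  exact sub_eq_zero.1 ht

end

/-! ### Inverting the parabolic operator -/

section

variable {X : Type*} [NormedAddCommGroup X] [NormedSpace ℂ X]

/-- The correlation `τ ↦ ∫ ψ (σ + τ) u(σ) dσ` of a function with a scalar test function. -/
def correlation (ψ : ℝ → ℝ) (u : ℝ → X) (τ : ℝ) : X := ∫ σ, ψ (σ + τ) • u σ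

theorem correlation_eq (ψ : ℝ → ℝ) (u : ℝ → X) (τ : ℝ) :
    correlation ψ u τ = ∫ t, ψ t • u (t - τ) := by
  rw [correlation, ← integral_sub_right_eq_self _ τ]
  simp

theorem integrable_correlation {p : ENNReal} (hp : 1 ≤ p) {u : ℝ → X} (hu : MemLp u p volume)
    {ψ : ℝ → ℝ} (hψ : Continuous ψ) (hψc : HasCompactSupport ψ) (τ : ℝ) :
    Integrable fun σ => ψ (σ + τ) • u σ := by
  have h1 : Continuous fun σ => ψ (σ + τ) := by fun_prop
  have h2 : HasCompactSupport fun σ => ψ (σ + τ) := hψc.comp_homeomorph (Homeomorph.addRight τ)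
  exact (hu.locallyIntegrable hp).integrable_smul_left_of_hasCompactSupport h1 h2

theorem correlation_add {p : ENNReal} (hp : 1 ≤ p) {u v : ℝ → X} (hu : MemLp u p volume)
    (hv : MemLp v p volume) {ψ : ℝ → ℝ} (hψ : Continuous ψ) (hψc : HasCompactSupport ψ) (τ : ℝ) :
    correlation ψ (u + v) τ = correlation ψ u τ + correlation ψ v τ := by
  rw [correlation, correlation, correlation, ← integral_add
    (integrable_correlation hp hu hψ hψc τ) (integrable_correlation hp hv hψ hψc τ)]
  simp

/-- A correlation is a convolution with the reflected function, so differentiation falls on the test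
function. -/
theorem hasDerivAt_correlation {p : ENNReal} (hp : 1 ≤ p) {u : ℝ → X} (hu : MemLp u p volume)
    {ψ : ℝ → ℝ} (hψ : ContDiff ℝ 1 ψ) (hψc : HasCompactSupport ψ) (τ : ℝ) :
    HasDerivAt (correlation ψ u) (correlation (deriv ψ) u τ) τ := by
  have hneg : MemLp (fun t => u (-t)) p volume :=
    hu.comp_measurePreserving (Measure.measurePreserving_neg volume)
  have h := hψc.hasDerivAt_convolution_right (ContinuousLinearMap.lsmul ℝ ℝ).flip
    (hneg.locallyIntegrable hp) hψ τ
  have hrw : ∀ χ : ℝ → ℝ, correlation χ u = convolution (fun t => u (-t)) χ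
      (ContinuousLinearMap.lsmul ℝ ℝ).flip volume := by
    intro χ
    funext r
    rw [correlation, convolution, ← integral_neg_eq_self]
    refine integral_congr_ae (Eventually.of_forall fun t => ?_)
    simp [neg_add_eq_sub]
  rw [hrw ψ, hrw (deriv ψ)]
  exact h

theorem exists_norm_correlation_integral_le {E : Type*} [NormedAddCommGroup E] {p : ENNReal}
    (hp : 1 ≤ p) {u : ℝ → E}
    (hu : MemLp u p volume) {ψ : ℝ → ℝ} (hψ : Continuous ψ) (hψc : HasCompactSupport ψ) :
    ∃ C, ∀ τ, Integrable (fun t => |ψ t| * ‖u (t - τ)‖) ∧ ∫ t, |ψ t| * ‖u (t - τ)‖ ≤ C := by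
  have : p.HolderConjugate (1 - p⁻¹)⁻¹ := ENNReal.HolderConjugate.inv_one_sub_inv' hp
  have hk : MemLp (fun t => |ψ t|) (1 - p⁻¹)⁻¹ (volume.restrict univ) := by
    rw [Measure.restrict_univ]
    exact (hψ.memLp_of_hasCompactSupport hψc).norm
  obtain ⟨C, hC⟩ := exists_integral_mul_norm_comp_le hu hk
  refine ⟨C, fun τ => ?_⟩
  have h := hC (fun t => t - τ) (measurePreserving_sub_right volume τ)
  rwa [integrableOn_univ, setIntegral_univ] at h

theorem exists_norm_correlation_le {p : ENNReal} (hp : 1 ≤ p) {u : ℝ → X}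
    (hu : MemLp u p volume) {ψ : ℝ → ℝ} (hψ : Continuous ψ) (hψc : HasCompactSupport ψ) :
    ∃ C, ∀ τ, ‖correlation ψ u τ‖ ≤ C := by
  obtain ⟨C, hC⟩ := exists_norm_correlation_integral_le hp hu hψ hψc
  refine ⟨C, fun τ => ?_⟩
  rw [correlation_eq]
  refine (norm_integral_le_of_norm_le (hC τ).1 (Eventually.of_forall fun t => ?_)).trans (hC τ).2
  rw [norm_smul, Real.norm_eq_abs]

theorem norm_semigroup_le {S : ℝ → X →L[ℂ] X} {M w : ℝ}
    (hM : ∀ t : ℝ, 0 ≤ t → ‖S t‖ ≤ M * Real.exp (-w * t)) (hw : 0 < w) {r : ℝ} (hr : 0 ≤ r) :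
    ‖S r‖ ≤ M := by
  refine (hM r hr).trans (mul_le_of_le_one_right (nonneg_of_stable hM) ?_)
  rw [Real.exp_le_one_iff]
  nlinarith

theorem integrableOn_semigroup_apply {S : ℝ → X →L[ℂ] X} (hS : IsMeasurableSemigroup S) {M w : ℝ}
    (hM : ∀ t : ℝ, 0 ≤ t → ‖S t‖ ≤ M * Real.exp (-w * t)) (hw : 0 < w) (y : X) :
    IntegrableOn (fun r => S r y) (Ioi 0) := by
  have h := (((exp_neg_integrableOn_Ioi 0 hw).const_mul M).mul_const ‖y‖)
  refine h.mono' (hS.measurable y) ?_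
  filter_upwards [ae_restrict_mem measurableSet_Ioi] with r hr
  exact (S r).le_of_opNorm_le (hM r (le_of_lt hr)) y

theorem intervalIntegrable_semigroup_apply {S : ℝ → X →L[ℂ] X} (hS : IsMeasurableSemigroup S)
    {M w : ℝ} (hM : ∀ t : ℝ, 0 ≤ t → ‖S t‖ ≤ M * Real.exp (-w * t)) (hw : 0 < w) (y : X) {t : ℝ}
    (ht : 0 ≤ t) : IntervalIntegrable (fun r => S r y) volume 0 t :=
  (intervalIntegrable_iff_integrableOn_Ioc_of_le ht).2
    ((integrableOn_semigroup_apply hS hM hw y).mono_set Ioc_subset_Ioi_self)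

theorem norm_intervalIntegral_semigroup_le {S : ℝ → X →L[ℂ] X} {M w : ℝ}
    (hM : ∀ t : ℝ, 0 ≤ t → ‖S t‖ ≤ M * Real.exp (-w * t)) (hw : 0 < w) (y : X) {t : ℝ}
    (ht : 0 ≤ t) : ‖∫ r in (0 : ℝ)..t, S r y‖ ≤ M * t * ‖y‖ := by
  have h := intervalIntegral.norm_integral_le_of_norm_le_const (a := 0) (b := t)
    (f := fun r => S r y) (C := M * ‖y‖) fun r hr => by
      rw [uIoc_of_le ht] at hr
      exact (S r).le_of_opNorm_le (norm_semigroup_le hM hw hr.1.le) y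
  rw [sub_zero, abs_of_nonneg ht] at h
  linarith

/-- On `D(A)` the integral form of the generator bounds `S r x - x` by a multiple of `r`, which
recovers continuity at `0`. -/
theorem IsNegGenerator.tendsto_zero {S : ℝ → X →L[ℂ] X} {A : X →ₗ.[ℂ] X}
    (hA : IsNegGenerator S A) {M w : ℝ}
    (hM : ∀ t : ℝ, 0 ≤ t → ‖S t‖ ≤ M * Real.exp (-w * t)) (hw : 0 < w) {x y : X}
    (hxy : (x, y) ∈ A.graph) : Tendsto (fun r => S r x) (𝓝[≥] 0) (𝓝 x) := by
  have h := (hA x y).1 hxy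
  rw [tendsto_iff_norm_sub_tendsto_zero]
  have h1 : Tendsto (fun r : ℝ => M * r * ‖y‖) (𝓝[≥] 0) (𝓝 0) := by
    have : Continuous fun r : ℝ => M * r * ‖y‖ := by fun_prop
    simpa using (this.tendsto 0).mono_left nhdsWithin_le_nhds
  refine squeeze_zero' (Eventually.of_forall fun _ => norm_nonneg _) ?_ h1
  filter_upwards [self_mem_nhdsWithin] with r hr
  rw [h r hr, sub_sub_cancel_left, norm_neg]
  exact norm_intervalIntegral_semigroup_le hM hw y hr

/-- For `τ ≥ 0` the function `ψ (· + τ)` is `ψ` moved to the left, hence still an admissible test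
function on `(-∞, t₀)`. -/
theorem HasWeakDeriv.correlation_eq {t₀ : ℝ} {u u' : ℝ → X} (h : HasWeakDeriv t₀ u u')
    {ψ : ℝ → ℝ} (hψ : ContDiff ℝ (⊤ : ℕ∞) ψ) (hψc : HasCompactSupport ψ)
    (hψt : tsupport ψ ⊆ Iio t₀) {τ : ℝ} (hτ : 0 ≤ τ) :
    correlation (deriv ψ) ((Iio t₀).indicator u) τ =
      -correlation ψ ((Iio t₀).indicator u') τ := by
  have hrw : ∀ (χ : ℝ → ℝ) (v : ℝ → X), correlation χ ((Iio t₀).indicator v) τ =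
      ∫ t in Iio t₀, χ (t + τ) • v t := by
    intro χ v
    rw [correlation, ← integral_indicator measurableSet_Iio]
    refine integral_congr_ae (Eventually.of_forall fun t => ?_)
    by_cases ht : t ∈ Iio t₀
    · simp only [indicator_of_mem ht]
    · simp only [indicator_of_notMem ht, smul_zero]
  have h1 := h (fun t => ψ (t + τ)) (by fun_prop)
    (hψc.comp_homeomorph (Homeomorph.addRight τ)) (fun t ht => ?_)
  · rw [hrw, hrw, ← h1]
    simp only [deriv_comp_add_const]
  · have h2 : t + τ ∈ tsupport ψ := by
      have h3 := tsupport_comp_subset_preimage ψ (f := fun t : ℝ => t + τ) (by fun_prop)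
      exact h3 ht
    have h4 : t + τ < t₀ := hψt h2
    rw [mem_Iio]
    linarith

variable [CompleteSpace X]

theorem IsNegGenerator.hasDerivAt {S : ℝ → X →L[ℂ] X} {A : X →ₗ.[ℂ] X}
    (hS : IsMeasurableSemigroup S) (hA : IsNegGenerator S A) {M w : ℝ}
    (hM : ∀ t : ℝ, 0 ≤ t → ‖S t‖ ≤ M * Real.exp (-w * t)) (hw : 0 < w) {x y : X}
    (hxy : (x, y) ∈ A.graph) {r : ℝ} (hr : 0 < r) : HasDerivAt (fun r => S r x) (-S r y) r := by
  have h := (hA x y).1 hxy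
  have h1 : HasDerivAt (fun t => x - ∫ r in (0 : ℝ)..t, S r y) (-S r y) r := by
    refine (intervalIntegral.integral_hasDerivAt_right
      (intervalIntegrable_semigroup_apply hS hM hw y hr.le) ?_ ?_).const_sub x
    · exact ⟨Ioi 0, Ioi_mem_nhds hr, hS.measurable y⟩
    · exact (hS.continuousOn_apply y).continuousAt (Ioi_mem_nhds hr)
  refine h1.congr_of_eventuallyEq ?_
  filter_upwards [Ioi_mem_nhds hr] with t ht
  exact h t (le_of_lt ht)

/-- The graph is cut out by equations between bounded operators, `S t` and the integrated semigroup
`J`, and these commute with Bochner integrals. -/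
theorem IsNegGenerator.correlation_mem_graph {S : ℝ → X →L[ℂ] X} {A : X →ₗ.[ℂ] X}
    (hS : IsMeasurableSemigroup S) (hA : IsNegGenerator S A) {M w : ℝ}
    (hM : ∀ t : ℝ, 0 ≤ t → ‖S t‖ ≤ M * Real.exp (-w * t)) (hw : 0 < w)
    {p : ENNReal} (hp : 1 ≤ p) {u a : ℝ → X} (hu : MemLp u p volume) (ha : MemLp a p volume)
    (hua : ∀ᵐ t : ℝ, (u t, a t) ∈ A.graph) {ψ : ℝ → ℝ} (hψ : Continuous ψ)
    (hψc : HasCompactSupport ψ) (τ : ℝ) :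
    (correlation ψ u τ, correlation ψ a τ) ∈ A.graph := by
  rw [hA]
  intro t ht
  let J : X →L[ℂ] X := LinearMap.mkContinuous
    { toFun := fun y => ∫ r in (0 : ℝ)..t, S r y
      map_add' := fun y z => by
        rw [← intervalIntegral.integral_add
          (intervalIntegrable_semigroup_apply hS hM hw y ht)
          (intervalIntegrable_semigroup_apply hS hM hw z ht)]
        simp
      map_smul' := fun c y => by
        simp only [map_smul, RingHom.id_apply]
        rw [intervalIntegral.integral_smul] } (M * t)
    fun y => norm_intervalIntegral_semigroup_le hM hw y ht
  have hJ : ∀ y, J y = ∫ r in (0 : ℝ)..t, S r y := fun y => rfl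
  have h1 := integrable_correlation hp hu hψ hψc τ
  have h2 := integrable_correlation hp ha hψ hψc τ
  rw [← hJ, correlation, correlation, ← ContinuousLinearMap.integral_comp_comm _ h1,
    ← ContinuousLinearMap.integral_comp_comm _ h2, ← integral_sub h1 (J.integrable_comp h2)]
  refine integral_congr_ae ?_
  filter_upwards [hua] with σ hσ
  rw [ContinuousLinearMap.map_smul_of_tower, ContinuousLinearMap.map_smul_of_tower, ← smul_sub,
    (hA _ _).1 hσ t ht, hJ]

theorem integral_semigroup_apply_correlation {S : ℝ → X →L[ℂ] X}
    (hS : IsMeasurableSemigroup S) {M w : ℝ}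
    (hM : ∀ t : ℝ, 0 ≤ t → ‖S t‖ ≤ M * Real.exp (-w * t)) (hw : 0 < w)
    {p : ENNReal} (hp : 1 ≤ p) {F : ℝ → X} (hF : MemLp F p volume) {ψ : ℝ → ℝ}
    (hψ : Continuous ψ) (hψc : HasCompactSupport ψ) :
    ∫ τ in Ioi 0, S τ (correlation ψ F τ) = ∫ t, ψ t • fracInt S 1 F t := by
  have hM0 := nonneg_of_stable hM
  let Ψ : ℝ → ℝ → X := fun τ t => ψ t • S τ (F (t - τ))
  have hΨm : AEStronglyMeasurable (Function.uncurry Ψ)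
      ((volume.restrict (Ioi 0)).prod volume) := by
    have hψ2 : Continuous fun z : ℝ × ℝ => ψ z.2 := by fun_prop
    refine hψ2.aestronglyMeasurable.smul ?_
    refine aestronglyMeasurable_clm_apply (T := fun z : ℝ × ℝ => S z.1)
      (fun x => (hS.measurable x).comp_fst) ?_
    exact hF.1.comp_quasiMeasurePreserving (QuasiMeasurePreserving.prod_of_right
      (measurable_snd.sub measurable_fst) (Eventually.of_forall fun τ =>
        (measurePreserving_sub_right volume τ).quasiMeasurePreserving))
  have hshift : ∀ τ, Integrable fun t => ψ t • F (t - τ) := by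
    intro τ
    simpa using (integrable_correlation hp hF hψ hψc τ).comp_sub_right τ
  have hΨτ : ∀ τ, Ψ τ = fun t => S τ (ψ t • F (t - τ)) := by
    intro τ
    funext t
    simp only [Ψ]
    rw [ContinuousLinearMap.map_smul_of_tower]
  obtain ⟨C, hC⟩ := exists_norm_correlation_integral_le hp hF hψ hψc
  have hΨ : Integrable (Function.uncurry Ψ) ((volume.restrict (Ioi 0)).prod volume) := by
    rw [integrable_prod_iff hΨm]
    refine ⟨Eventually.of_forall fun τ => ?_, ?_⟩
    · simp only [Function.uncurry_apply_pair]
      rw [hΨτ]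
      exact (S τ).integrable_comp (hshift τ)
    · refine (((exp_neg_integrableOn_Ioi 0 hw).const_mul M).mul_const C).mono'
        hΨm.norm.integral_prod_right' ?_
      filter_upwards [ae_restrict_mem measurableSet_Ioi] with τ hτ
      rw [Real.norm_of_nonneg (integral_nonneg fun t => norm_nonneg _)]
      simp only [Function.uncurry_apply_pair]
      calc ∫ t, ‖Ψ τ t‖ ≤ ∫ t, M * Real.exp (-w * τ) * (|ψ t| * ‖F (t - τ)‖) := by
            refine integral_mono_of_nonneg (Eventually.of_forall fun t => norm_nonneg _)
              ((hC τ).1.const_mul _) (Eventually.of_forall fun t => ?_)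
            refine (norm_smul_apply_le hM (le_of_lt hτ) (ψ t) (F (t - τ))).trans_eq ?_
            ring
        _ ≤ M * Real.exp (-w * τ) * C := by
            rw [integral_const_mul]
            exact mul_le_mul_of_nonneg_left (hC τ).2 (by positivity)
  have hswap := integral_integral_swap hΨ
  have h1 : ∀ τ, ∫ t, Ψ τ t = S τ (correlation ψ F τ) := by
    intro τ
    rw [hΨτ, ContinuousLinearMap.integral_comp_comm _ (hshift τ), correlation_eq]
  have h2 : ∀ t, ∫ τ in Ioi 0, Ψ τ t = ψ t • fracInt S 1 F t := by
    intro t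
    rw [fracInt_one, ← integral_smul]
  simp only [h1, h2] at hswap
  exact hswap

/-- A product rule without norm differentiability of `S`: the slope is `S` applied to the slope of
`G`, plus the slope of the orbit of the fixed vector `G r`, so only `G r` has to lie in `D(A)`. -/
theorem IsNegGenerator.hasDerivAt_apply {S : ℝ → X →L[ℂ] X} {A : X →ₗ.[ℂ] X}
    (hS : IsMeasurableSemigroup S) (hA : IsNegGenerator S A) {M w : ℝ}
    (hM : ∀ t : ℝ, 0 ≤ t → ‖S t‖ ≤ M * Real.exp (-w * t)) (hw : 0 < w) {G : ℝ → X} {G' y : X}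
    {r : ℝ} (hr : 0 < r) (hG : HasDerivAt G G' r) (hy : (G r, y) ∈ A.graph) :
    HasDerivAt (fun r => S r (G r)) (S r (G' - y)) r := by
  have h1 := hasDerivAt_iff_tendsto_slope.1 (hA.hasDerivAt hS hM hw hy hr)
  have h2 := tendsto_semigroup_apply hS hM hw hr
    (tendsto_id.mono_left nhdsWithin_le_nhds) (hasDerivAt_iff_tendsto_slope.1 hG)
  rw [hasDerivAt_iff_tendsto_slope, map_sub, sub_eq_add_neg]
  refine (h2.add h1).congr fun a => ?_
  simp only [slope_def_module, id]
  rw [ContinuousLinearMap.map_smul_of_tower, ← smul_add, map_sub]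
  congr 1
  abel

/-- The derivative of `S τ (G τ)` is `-S τ (Q τ)` because the two terms with `H = A G` cancel.
Integrate over `(0, ∞)`: exponential decay removes the limit at infinity, and `G 0 ∈ D(A)` gives
continuity at `0`. -/
theorem IsNegGenerator.integral_eq {S : ℝ → X →L[ℂ] X} {A : X →ₗ.[ℂ] X}
    (hS : IsMeasurableSemigroup S) (hA : IsNegGenerator S A) {M w : ℝ}
    (hM : ∀ t : ℝ, 0 ≤ t → ‖S t‖ ≤ M * Real.exp (-w * t)) (hw : 0 < w) {G Q H : ℝ → X}
    (hG0 : ContinuousWithinAt G (Ici 0) 0)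
    (hGH : ∀ τ, 0 ≤ τ → (G τ, H τ) ∈ A.graph)
    (hG : ∀ τ, 0 < τ → HasDerivAt G (H τ - Q τ) τ) (hQ : ContinuousOn Q (Ioi 0)) {C C' : ℝ}
    (hQC : ∀ τ, ‖Q τ‖ ≤ C) (hGC : ∀ τ, ‖G τ‖ ≤ C') :
    ∫ τ in Ioi 0, S τ (Q τ) = G 0 := by
  have hM0 := nonneg_of_stable hM
  have hder : ∀ τ ∈ Ioi (0 : ℝ), HasDerivAt (fun τ => S τ (G τ)) (-S τ (Q τ)) τ := by
    intro τ hτ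
    have h := hA.hasDerivAt_apply hS hM hw hτ (hG τ hτ) (hGH τ (le_of_lt hτ))
    rwa [sub_sub_cancel_left, map_neg] at h
  have hcont : ContinuousWithinAt (fun τ => S τ (G τ)) (Ici 0) 0 := by
    have h1 : Tendsto (fun τ => S τ (G τ - G 0)) (𝓝[≥] 0) (𝓝 0) := by
      have h3 : Tendsto (fun a => M * ‖G a - G 0‖) (𝓝[≥] 0) (𝓝 0) := by
        simpa using (tendsto_iff_norm_sub_tendsto_zero.1 hG0).const_mul M
      refine squeeze_zero_norm' ?_ h3
      filter_upwards [self_mem_nhdsWithin] with τ hτ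
      exact (S τ).le_of_opNorm_le (norm_semigroup_le hM hw hτ) _
    have h2 := h1.add (hA.tendsto_zero hM hw (hGH 0 le_rfl))
    rw [ContinuousWithinAt, hS.map_zero]
    refine (by simpa using h2 : Tendsto (fun τ => S τ (G τ - G 0) + S τ (G 0)) _ _).congr
      fun τ => ?_
    rw [map_sub, sub_add_cancel]
  have hint : IntegrableOn (fun τ => -S τ (Q τ)) (Ioi 0) := by
    refine Integrable.neg ?_
    refine (((exp_neg_integrableOn_Ioi 0 hw).const_mul M).mul_const C).mono' ?_ ?_
    · exact (continuousOn_semigroup_apply hS hM hw (fun a ha => ha) continuousOn_id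
        hQ).aestronglyMeasurable measurableSet_Ioi
    · filter_upwards [ae_restrict_mem measurableSet_Ioi] with τ hτ
      refine ((S τ).le_of_opNorm_le (hM τ (le_of_lt hτ)) _).trans ?_
      exact mul_le_mul_of_nonneg_left (hQC τ) (by positivity)
  have hlim : Tendsto (fun τ => S τ (G τ)) atTop (𝓝 0) := by
    have h1 : Tendsto (fun τ : ℝ => M * Real.exp (-w * τ) * C') atTop (𝓝 0) := by
      have h2 : Tendsto (fun τ : ℝ => Real.exp (-w * τ)) atTop (𝓝 0) :=
        Real.tendsto_exp_atBot.comp (tendsto_id.const_mul_atTop_of_neg (neg_lt_zero.2 hw))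
      simpa using (h2.const_mul M).mul_const C'
    refine squeeze_zero_norm' ?_ h1
    filter_upwards [eventually_ge_atTop 0] with τ hτ
    refine ((S τ).le_of_opNorm_le (hM τ hτ) _).trans ?_
    exact mul_le_mul_of_nonneg_left (hGC τ) (by positivity)
  have h := integral_Ioi_of_hasDerivAt_of_tendsto hcont hder hint hlim
  rw [integral_neg, hS.map_zero, zero_sub, neg_inj] at h
  exact h

/-- Variation of constants in weak form. Since `u` is only weakly differentiable, it is paired with
the translates of a test function `ψ`; the pairing is differentiable in the translation parameter.
Fubini then identifies the outcome as `ψ` tested against `𝔍^1 f`. -/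
theorem HasParabolic.ae_eq_fracInt {S : ℝ → X →L[ℂ] X} {A : X →ₗ.[ℂ] X}
    (hS : IsMeasurableSemigroup S) (hA : IsNegGenerator S A) {M w : ℝ}
    (hM : ∀ t : ℝ, 0 ≤ t → ‖S t‖ ≤ M * Real.exp (-w * t)) (hw : 0 < w)
    {p : ENNReal} (hp : 1 ≤ p) {t₀ : ℝ} {u f : ℝ → X} (h : HasParabolic A p t₀ u f) :
    u =ᵐ[leftLine t₀] fracInt S 1 f := by
  obtain ⟨hu, u', a, hu', ha, hweak, hgraph, hf⟩ := h
  have hU := memLp_indicator_Iio hu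
  have hU' := memLp_indicator_Iio hu'
  have hAa := memLp_indicator_Iio ha
  have hUA : ∀ᵐ t : ℝ, ((Iio t₀).indicator u t, (Iio t₀).indicator a t) ∈ A.graph := by
    filter_upwards [(ae_restrict_iff' measurableSet_Iio).1 hgraph] with t ht
    by_cases h : t ∈ Iio t₀
    · simpa only [indicator_of_mem h] using ht h
    · simp only [indicator_of_notMem h]
      exact A.graph.zero_mem
  set U := (Iio t₀).indicator u with hUdef
  set U' := (Iio t₀).indicator u' with hUdef'
  set B := (Iio t₀).indicator a with hBdef
  have hF : MemLp (U' + B) p volume := hU'.add hAa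
  have hcont := continuous_fracInt hS hM hw hp (order_of_one_le hp le_rfl) hF
  have hkey : ∀ᵐ t : ℝ, t ∈ Iio t₀ → U t - fracInt S 1 (U' + B) t = 0 := by
    refine isOpen_Iio.ae_eq_zero_of_integral_contDiff_smul_eq_zero
      (((hU.locallyIntegrable hp).sub hcont.locallyIntegrable).locallyIntegrableOn _) ?_
    intro ψ hψ hψc hψt
    have hψ0 := hψ.continuous
    have hψ1 : ContDiff ℝ 1 ψ := hψ.of_le (by exact_mod_cast le_top)
    obtain ⟨C, hC⟩ := exists_norm_correlation_le hp hF hψ0 hψc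
    obtain ⟨C', hC'⟩ := exists_norm_correlation_le hp hU hψ0 hψc
    have hI := hA.integral_eq hS hM hw (G := correlation ψ U) (H := correlation ψ B)
      (Q := correlation ψ (U' + B))
      (hasDerivAt_correlation hp hU hψ1 hψc 0).continuousAt.continuousWithinAt
      (fun τ _ => hA.correlation_mem_graph hS hM hw hp hU hAa hUA hψ0 hψc τ)
      (fun τ hτ => by
        have h1 := hasDerivAt_correlation hp hU hψ1 hψc τ
        rw [hweak.correlation_eq hψ hψc hψt hτ.le] at h1
        convert! h1 using 1
        rw [correlation_add hp hU' hAa hψ0 hψc]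
        abel)
      (fun τ _ => (hasDerivAt_correlation hp hF hψ1 hψc τ).continuousAt.continuousWithinAt) hC hC'
    rw [integral_semigroup_apply_correlation hS hM hw hp hF hψ0 hψc, correlation] at hI
    simp only [add_zero] at hI
    simp only [smul_sub]
    rw [integral_sub _ _, hI, sub_self]
    · simpa using integrable_correlation hp hU hψ0 hψc 0
    · exact hcont.locallyIntegrable.integrable_smul_left_of_hasCompactSupport hψ0 hψc
  have hfF : f =ᵐ[leftLine t₀] U' + B := by
    filter_upwards [hf, ae_restrict_mem measurableSet_Iio] with t ht ht0
    rw [ht, Pi.add_apply, hUdef', hBdef, indicator_of_mem ht0, indicator_of_mem ht0]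
  filter_upwards [ae_restrict_of_ae hkey, ae_restrict_mem measurableSet_Iio] with t ht ht0
  rw [fracInt_congr_ae one_ne_zero (le_of_lt ht0) hfF, ← sub_eq_zero, ← ht ht0, hUdef,
    indicator_of_mem ht0]

end

/-! ### Fractional derivatives and the Dirichlet solution -/

section

variable {X : Type*} [NormedAddCommGroup X] [NormedSpace ℂ X]

theorem fracInt_zero (S : ℝ → X →L[ℂ] X) (u : ℝ → X) : fracInt S 0 u = u := by
  funext t
  simp [fracInt]

theorem HasParabolic.memLp_right {A : X →ₗ.[ℂ] X} {p : ENNReal} {t₀ : ℝ} {u f : ℝ → X}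
    (h : HasParabolic A p t₀ u f) : MemLp f p (leftLine t₀) := by
  obtain ⟨-, u', a, hu', ha, -, -, hf⟩ := h
  exact (memLp_congr_ae hf).2 (hu'.add ha)

theorem HasParabolic.congr_right {A : X →ₗ.[ℂ] X} {p : ENNReal} {t₀ : ℝ} {u f f' : ℝ → X}
    (h : HasParabolic A p t₀ u f) (hf : f' =ᵐ[leftLine t₀] f) : HasParabolic A p t₀ u f' := by
  obtain ⟨hu, u', a, hu', ha, hw, hg, h⟩ := h
  exact ⟨hu, u', a, hu', ha, hw, hg, hf.trans h⟩

theorem HasParabolicPow.memLp_right {A : X →ₗ.[ℂ] X} {p : ENNReal} {t₀ : ℝ} {n : ℕ}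
    {u f : ℝ → X} (h : HasParabolicPow A p t₀ n u f) : MemLp f p (leftLine t₀) := by
  cases n with
  | zero => exact (memLp_congr_ae h.2).2 h.1
  | succ n =>
    obtain ⟨v, -, hv⟩ := h
    exact hv.memLp_right

theorem HasParabolicPow.congr_right {A : X →ₗ.[ℂ] X} {p : ENNReal} {t₀ : ℝ} {n : ℕ}
    {u f f' : ℝ → X} (h : HasParabolicPow A p t₀ n u f) (hf : f' =ᵐ[leftLine t₀] f) :
    HasParabolicPow A p t₀ n u f' := by
  cases n with
  | zero => exact ⟨h.1, hf.trans h.2⟩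
  | succ n =>
    obtain ⟨v, h1, h2⟩ := h
    exact ⟨v, h1, h2.congr_right hf⟩

theorem HasParabolicPow.congr_left {A : X →ₗ.[ℂ] X} {p : ENNReal} {t₀ : ℝ} {n : ℕ}
    {u u' f : ℝ → X} (h : HasParabolicPow A p t₀ n u f) (hu : u =ᵐ[leftLine t₀] u') :
    HasParabolicPow A p t₀ n u' f := by
  induction n generalizing f with
  | zero => exact ⟨(memLp_congr_ae hu).1 h.1, h.2.trans hu⟩
  | succ n ih =>
    obtain ⟨v, h1, h2⟩ := h
    exact ⟨v, ih h1, h2⟩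

theorem FracIntConvergesAt.zero (S : ℝ → X →L[ℂ] X) (u : ℝ → X) (t : ℝ) :
    FracIntConvergesAt S 0 u t := Or.inl rfl

theorem fracInt_ae_eq_of_ae_eq {S : ℝ → X →L[ℂ] X} {t₀ r : ℝ} {u u' : ℝ → X}
    (h : u =ᵐ[leftLine t₀] u') : fracInt S r u =ᵐ[leftLine t₀] fracInt S r u' := by
  by_cases hr : r = 0
  · rwa [hr, fracInt_zero, fracInt_zero]
  · filter_upwards [ae_restrict_mem measurableSet_Iio] with t ht
    exact fracInt_congr_ae hr (le_of_lt ht) h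

theorem HasFracDeriv.congr_left {S : ℝ → X →L[ℂ] X} {A : X →ₗ.[ℂ] X} {p : ENNReal} {t₀ s : ℝ}
    {g g' f : ℝ → X} (h : HasFracDeriv S A p t₀ s g f) (hg : g =ᵐ[leftLine t₀] g') :
    HasFracDeriv S A p t₀ s g' f := by
  refine ⟨(memLp_congr_ae hg).1 h.1, ?_, h.2.2.congr_left (fracInt_ae_eq_of_ae_eq hg)⟩
  filter_upwards [h.2.1, ae_restrict_mem measurableSet_Iio] with t ht ht0
  exact ht.congr_ae (le_of_lt ht0) hg

section Stable

variable {S : ℝ → X →L[ℂ] X} {A : X →ₗ.[ℂ] X} {M w : ℝ} {p : ENNReal} {t₀ : ℝ}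

theorem isBddCont_fracInt (hS : IsMeasurableSemigroup S)
    (hM : ∀ t : ℝ, 0 ≤ t → ‖S t‖ ≤ M * Real.exp (-w * t)) (hw : 0 < w) (hp : 1 ≤ p) {s : ℝ}
    (hs : (p = 1 ∧ 1 ≤ s) ∨ (p ≠ 1 ∧ p⁻¹.toReal < s)) {f : ℝ → X}
    (hf : MemLp f p (leftLine t₀)) : IsBddCont t₀ (fracInt S s f) := by
  have hF := memLp_indicator_Iio hf
  have hEq : EqOn (fracInt S s f) (fracInt S s ((Iio t₀).indicator f)) (Iic t₀) := fun t ht =>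
    (fracInt_congr_ae (order_pos hs).ne' ht (indicator_Iio_ae_eq t₀ f)).symm
  obtain ⟨C, hC⟩ := exists_norm_fracInt_le hM hw hp hs hF
  exact ⟨(continuous_fracInt hS hM hw hp hs hF).continuousOn.congr hEq, C,
    fun t ht => by rw [hEq ht]; exact hC t⟩

theorem HasFracDeriv.memLp_right {s : ℝ} {g f : ℝ → X} (h : HasFracDeriv S A p t₀ s g f) :
    MemLp f p (leftLine t₀) :=
  h.2.2.memLp_right

variable [CompleteSpace X]

theorem fracInt_fracInt_of_memLp (hS : IsMeasurableSemigroup S)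
    (hM : ∀ t : ℝ, 0 ≤ t → ‖S t‖ ≤ M * Real.exp (-w * t)) (hw : 0 < w) (hp : 1 ≤ p)
    {a b : ℝ} (ha : 0 < a) (hb : 0 < b) (hab : 1 ≤ a + b) {f : ℝ → X}
    (hf : MemLp f p (leftLine t₀)) {t : ℝ} (ht : t ≤ t₀) :
    fracInt S a (fracInt S b f) t = fracInt S (a + b) f t := by
  have hF := memLp_indicator_Iio hf
  have hFf := indicator_Iio_ae_eq t₀ f
  obtain ⟨C, hC⟩ := exists_gammaKernel_bound hp hw (order_of_one_le hp hab) hF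
  rw [← fracInt_congr_ae ha.ne' ht (fracInt_ae_eq_of_ae_eq hFf),
    fracInt_fracInt hS hM hw ha hb hF.1 (hC t).1,
    fracInt_congr_ae (add_pos ha hb).ne' ht hFf]

theorem HasParabolicPow.ae_eq_fracInt (hS : IsMeasurableSemigroup S) (hA : IsNegGenerator S A)
    (hM : ∀ t : ℝ, 0 ≤ t → ‖S t‖ ≤ M * Real.exp (-w * t)) (hw : 0 < w) (hp : 1 ≤ p)
    {n : ℕ} {u f : ℝ → X} (h : HasParabolicPow A p t₀ n u f) :
    u =ᵐ[leftLine t₀] fracInt S n f := by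
  induction n generalizing f with
  | zero =>
    rw [Nat.cast_zero, fracInt_zero]
    exact h.2.symm
  | succ n ih =>
    obtain ⟨v, h1, h2⟩ := h
    have hv := h2.ae_eq_fracInt hS hA hM hw hp
    refine (ih h1).trans ((fracInt_ae_eq_of_ae_eq hv).trans ?_)
    rcases Nat.eq_zero_or_pos n with rfl | hn
    · simp only [Nat.cast_zero, fracInt_zero, Nat.cast_one, zero_add]
      exact ae_eq_refl _
    · have hn' : (0 : ℝ) < n := by exact_mod_cast hn
      filter_upwards [ae_restrict_mem measurableSet_Iio] with t ht
      rw [fracInt_fracInt_of_memLp hS hM hw hp hn' one_pos (by linarith) h2.memLp_right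
        (le_of_lt ht), Nat.cast_add, Nat.cast_one]

/-- Undoes the outermost `j` factors of the power one at a time, each by
`HasParabolic.ae_eq_fracInt`. -/
theorem HasParabolicPow.fracInt_right (hS : IsMeasurableSemigroup S) (hA : IsNegGenerator S A)
    (hM : ∀ t : ℝ, 0 ≤ t → ‖S t‖ ≤ M * Real.exp (-w * t)) (hw : 0 < w) (hp : 1 ≤ p)
    {m j : ℕ} {u f : ℝ → X} (h : HasParabolicPow A p t₀ (m + j) u f) :
    HasParabolicPow A p t₀ m u (fracInt S j f) := by
  induction j generalizing m with
  | zero => simpa [fracInt_zero] using h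
  | succ j ih =>
    have hf := h.memLp_right
    rw [show m + (j + 1) = (m + 1) + j by ring] at h
    obtain ⟨v, h1, h2⟩ := ih h
    refine h1.congr_right (EventuallyEq.symm ?_)
    refine (h2.ae_eq_fracInt hS hA hM hw hp).trans ?_
    rcases Nat.eq_zero_or_pos j with rfl | hj
    · simp only [Nat.cast_zero, fracInt_zero, Nat.cast_one, zero_add]
      exact ae_eq_refl _
    · have hj' : (0 : ℝ) < j := by exact_mod_cast hj
      filter_upwards [ae_restrict_mem measurableSet_Iio] with t ht
      rw [fracInt_fracInt_of_memLp hS hM hw hp one_pos hj' (by linarith) hf (le_of_lt ht),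
        Nat.cast_add, Nat.cast_one, add_comm]

/-- The power is defined as a relation. It is single-valued since two outcomes have the same `𝔍^1`,
which is injective. -/
theorem HasParabolicPow.ae_unique (hS : IsMeasurableSemigroup S) (hA : IsNegGenerator S A)
    (hM : ∀ t : ℝ, 0 ≤ t → ‖S t‖ ≤ M * Real.exp (-w * t)) (hw : 0 < w) (hp : 1 ≤ p)
    {n : ℕ} {u f f' : ℝ → X} (h : HasParabolicPow A p t₀ n u f)
    (h' : HasParabolicPow A p t₀ n u f') : f =ᵐ[leftLine t₀] f' := by
  induction n generalizing f f' with
  | zero => exact h.2.trans h'.2.symm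
  | succ n ih =>
    obtain ⟨v, h1, h2⟩ := h
    obtain ⟨v', h1', h2'⟩ := h'
    exact ae_eq_of_fracInt_one_ae_eq hS hA hM hw hp h2.memLp_right h2'.memLp_right
      (((h2.ae_eq_fracInt hS hA hM hw hp).symm.trans (ih h1 h1')).trans
        (h2'.ae_eq_fracInt hS hA hM hw hp))

theorem HasFracDeriv.ae_unique (hS : IsMeasurableSemigroup S) (hA : IsNegGenerator S A)
    (hM : ∀ t : ℝ, 0 ≤ t → ‖S t‖ ≤ M * Real.exp (-w * t)) (hw : 0 < w) (hp : 1 ≤ p) {s : ℝ}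
    {g f f' : ℝ → X} (h : HasFracDeriv S A p t₀ s g f) (h' : HasFracDeriv S A p t₀ s g f') :
    f =ᵐ[leftLine t₀] f' :=
  h.2.2.ae_unique hS hA hM hw hp h'.2.2

/-- With `α = ⌈s⌉ - s`, inverting the power gives `𝔍^α g = 𝔍^⌈s⌉ f`. Applying `𝔍^(1-α)` turns this
into `𝔍^1 g = 𝔍^1 (𝔍^s f)`, and `𝔍^1` is injective. -/
theorem HasFracDeriv.ae_eq_fracInt (hS : IsMeasurableSemigroup S) (hA : IsNegGenerator S A)
    (hM : ∀ t : ℝ, 0 ≤ t → ‖S t‖ ≤ M * Real.exp (-w * t)) (hw : 0 < w) (hp : 1 ≤ p) {s : ℝ}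
    (hs : (p = 1 ∧ 1 ≤ s) ∨ (p ≠ 1 ∧ p⁻¹.toReal < s)) {g f : ℝ → X}
    (h : HasFracDeriv S A p t₀ s g f) : g =ᵐ[leftLine t₀] fracInt S s f := by
  have hs0 := order_pos hs
  have hf := h.memLp_right
  have hNf := h.2.2.ae_eq_fracInt hS hA hM hw hp
  have hα0 : 0 ≤ (⌈s⌉₊ : ℝ) - s := sub_nonneg.2 (Nat.le_ceil s)
  have hα1 : (⌈s⌉₊ : ℝ) - s < 1 := by linarith [Nat.ceil_lt_add_one hs0.le]
  rcases eq_or_lt_of_le hα0 with hα | hα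
  · rwa [← hα, fracInt_zero, sub_eq_zero.1 hα.symm] at hNf
  set α := (⌈s⌉₊ : ℝ) - s with hαdef
  have hN1 : (1 : ℝ) ≤ ⌈s⌉₊ := by exact_mod_cast Nat.one_le_ceil_iff.2 hs0
  have hF := memLp_indicator_Iio hf
  have hFf := indicator_Iio_ae_eq t₀ f
  have hG := memLp_indicator_Iio h.1
  have hGg := indicator_Iio_ae_eq t₀ g
  obtain ⟨C, hC⟩ := exists_norm_fracInt_le hM hw hp hs hF
  -- `𝔍^s F` is treated as a bounded function and `g` as an `L^p` function, so their difference goes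
  -- directly into `ae_eq_zero_of_forall_integral_eq_zero`.
  have hB : MemLp (fracInt S s ((Iio t₀).indicator f)) ⊤ volume :=
    memLp_top_of_bound (continuous_fracInt hS hM hw hp hs hF).aestronglyMeasurable C
      (Eventually.of_forall hC)
  have hBf : fracInt S s ((Iio t₀).indicator f) =ᵐ[leftLine t₀] fracInt S s f :=
    fracInt_ae_eq_of_ae_eq hFf
  have hz : ∀ t ≤ t₀, fracInt S 1 g t = fracInt S 1 (fracInt S s f) t := by
    intro t ht
    have h1 := fracInt_fracInt_of_memLp hS hM hw hp (a := 1 - α) (sub_pos.2 hα1) hα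
      (by linarith) h.1 ht
    have h2 := fracInt_fracInt_of_memLp hS hM hw hp (a := 1 - α) (b := ⌈s⌉₊) (sub_pos.2 hα1)
      (by linarith) (by linarith) hf ht
    have h3 := fracInt_fracInt_of_memLp hS hM hw hp one_pos hs0 (by linarith) hf ht
    rw [sub_add_cancel] at h1
    rw [← h1, h3, fracInt_congr_ae (sub_pos.2 hα1).ne' ht hNf, h2]
    congr 1
    rw [hαdef]
    ring
  have hIG := integrableOn_apply_of_memLp hS hM hw hp hG
  have hIB := integrableOn_apply_of_memLp hS hM hw le_top hB
  have h3 := ae_eq_zero_of_forall_integral_eq_zero hS hA (t₀ := t₀)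
    (H := (Iio t₀).indicator g - fracInt S s ((Iio t₀).indicator f))
    (fun t => IntegrableOn.congr_fun ((hIG t).sub (hIB t)) (fun τ _ => (map_sub (S τ) _ _).symm)
      measurableSet_Ioi) (fun t ht => by
      simp only [Pi.sub_apply, map_sub]
      rw [integral_sub (hIG t) (hIB t), ← fracInt_one, ← fracInt_one,
        fracInt_congr_ae one_ne_zero ht hGg, fracInt_congr_ae one_ne_zero ht hBf, hz t ht,
        sub_self])
  filter_upwards [h3, hGg, hBf] with t ht e1 e2
  rw [← e1, ← e2]
  exact sub_eq_zero.1 ht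

/-- Lowering the order by an integer leaves `⌈s⌉ - s` unchanged, so only the power of the parabolic
operator drops. -/
theorem HasFracDeriv.sub_natCast (hS : IsMeasurableSemigroup S) (hA : IsNegGenerator S A)
    (hM : ∀ t : ℝ, 0 ≤ t → ‖S t‖ ≤ M * Real.exp (-w * t)) (hw : 0 < w) (hp : 1 ≤ p) {s : ℝ}
    {g f : ℝ → X} (h : HasFracDeriv S A p t₀ s g f) {j : ℕ} (hj : (j : ℝ) ≤ s) :
    HasFracDeriv S A p t₀ (s - j) g (fracInt S j f) := by
  have hjN : j ≤ ⌈s⌉₊ := by exact_mod_cast hj.trans (Nat.le_ceil s)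
  have hceil : ⌈s - j⌉₊ = ⌈s⌉₊ - j := Nat.ceil_sub_natCast s j
  have hα : ((⌈s - j⌉₊ : ℕ) : ℝ) - (s - j) = (⌈s⌉₊ : ℝ) - s := by
    rw [hceil, Nat.cast_sub hjN]
    ring
  refine ⟨h.1, ?_, ?_⟩
  · rw [hα]
    exact h.2.1
  · rw [hα, hceil]
    refine HasParabolicPow.fracInt_right hS hA hM hw hp ?_
    rw [Nat.sub_add_cancel hjN]
    exact h.2.2

theorem exists_isDirichletSolution (hS : IsMeasurableSemigroup S) (hA : IsNegGenerator S A)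
    (hM : ∀ t : ℝ, 0 ≤ t → ‖S t‖ ≤ M * Real.exp (-w * t)) (hw : 0 < w) (hp : 1 ≤ p) {s : ℝ}
    (hs : (p = 1 ∧ 1 ≤ s) ∨ (p ≠ 1 ∧ p⁻¹.toReal < s)) {g f : ℝ → X}
    (h : HasFracDeriv S A p t₀ s g f) :
    ∃ u : ℝ → X, IsDirichletSolution S A p t₀ s (fracInt S s f) u := by
  have hs0 := order_pos hs
  have hf := h.memLp_right
  have hg := h.ae_eq_fracInt hS hA hM hw hp hs
  have h0 := h.congr_left hg
  have hb := isBddCont_fracInt hS hM hw hp hs hf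
  have hfl : (⌊s⌋₊ : ℝ) + Int.fract s = s := by
    rw [natCast_floor_eq_intCast_floor hs0.le, Int.floor_add_fract]
  let x : ℕ → X := fun k => fracInt S ((⌊s⌋₊ : ℝ) - k + 1) f t₀
  refine ⟨fun t => if t ≤ t₀ then fracInt S s f t else
    integralTerm S t₀ s (fracInt S s f) t + sumTerm S t₀ s x t, hb, ?_,
    fun t ht => if_pos ht, x, ?_, fun t ht => if_neg (not_le.2 ht)⟩
  -- For `s ≥ 1` the required derivative is `𝔍^1 f`; for `s < 1` its order is `0` and it is the data
  -- itself.
  · rcases le_or_gt 1 s with h1 | h1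
    · have h2 := h0.sub_natCast hS hA hM hw hp (j := 1) (by simpa using h1)
      rw [Nat.cast_one] at h2
      rw [max_eq_left (by linarith)]
      exact ⟨_, h2, isBddCont_fracInt hS hM hw hp (order_of_one_le hp le_rfl) hf⟩
    · rw [max_eq_right (by linarith)]
      refine ⟨_, ⟨h0.1, Eventually.of_forall fun t => ?_, ?_⟩, hb⟩
      · simpa using FracIntConvergesAt.zero S _ t
      · simp only [Nat.ceil_zero, Nat.cast_zero, sub_zero, fracInt_zero]
        exact ⟨h0.1, ae_eq_refl _⟩
  · intro k hk
    rw [Finset.mem_Icc] at hk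
    have hcast : ((⌊s⌋₊ - k + 1 : ℕ) : ℝ) = (⌊s⌋₊ : ℝ) - k + 1 := by
      rw [Nat.cast_add, Nat.cast_sub hk.2, Nat.cast_one]
    have hk1 : (1 : ℝ) ≤ k := by exact_mod_cast hk.1
    have hk2 : (k : ℝ) ≤ ⌊s⌋₊ := by exact_mod_cast hk.2
    have h2 := h0.sub_natCast hS hA hM hw hp (j := ⌊s⌋₊ - k + 1) (by
      rw [hcast]
      linarith [Int.fract_nonneg s])
    rw [hcast, show s - ((⌊s⌋₊ : ℝ) - k + 1) = Int.fract s + k - 1 by linarith] at h2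
    exact ⟨_, h2, (isBddCont_fracInt hS hM hw hp (order_of_one_le hp (by linarith)) hf).1, rfl⟩

/-- Continuity up to `t₀` upgrades almost everywhere equalities to pointwise ones, so the data must
equal `𝔍^s f` on `(-∞, t₀]` and the coefficients must be the values `𝔍^(⌊s⌋-k+1) f (t₀)`. What
remains is the formula of part (i). -/
theorem IsDirichletSolution.fracInt_eq (hS : IsMeasurableSemigroup S) (hA : IsNegGenerator S A)
    (hM : ∀ t : ℝ, 0 ≤ t → ‖S t‖ ≤ M * Real.exp (-w * t)) (hw : 0 < w) (hp : 1 ≤ p) {s : ℝ}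
    (hs : (p = 1 ∧ 1 ≤ s) ∨ (p ≠ 1 ∧ p⁻¹.toReal < s)) {g f g₀ u : ℝ → X}
    (h : HasFracDeriv S A p t₀ s g f) (hg₀ : g₀ =ᵐ[leftLine t₀] g)
    (hu : IsDirichletSolution S A p t₀ s g₀ u) {t : ℝ} (ht : t₀ < t) :
    fracInt S s ((Iic t₀).indicator f) t = u t := by
  have hs0 := order_pos hs
  have hf := h.memLp_right
  have hg := h.ae_eq_fracInt hS hA hM hw hp hs
  have h0 := h.congr_left hg₀.symm
  have hb := isBddCont_fracInt hS hM hw hp hs hf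
  have hEq : EqOn g₀ (fracInt S s f) (Iic t₀) :=
    eqOn_Iic_of_ae_eq hu.bddCont.1 hb.1 (hg₀.trans hg)
  have hfl : (⌊s⌋₊ : ℝ) + Int.fract s = s := by
    rw [natCast_floor_eq_intCast_floor hs0.le, Int.floor_add_fract]
  obtain ⟨x, hx, hux⟩ := hu.eq_right
  rw [hux t ht, ((fracInt_extension hS hM hw hp hs hf).2.2 t ht).2.2, integralTerm, sumTerm]
  congr 1
  · congr 1
    refine setIntegral_congr_fun measurableSet_Ioi fun τ hτ => ?_
    have h1 : 0 < (t - t₀) * τ := mul_pos (sub_pos.2 ht) hτ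
    rw [hEq (show t₀ - (t - t₀) * τ ∈ Iic t₀ from sub_le_self _ h1.le)]
  · refine Finset.sum_congr rfl fun k hk => ?_
    congr 2
    obtain ⟨d, hd, hdc, hdx⟩ := hx k hk
    rw [Finset.mem_Icc] at hk
    have hcast : ((⌊s⌋₊ - k + 1 : ℕ) : ℝ) = (⌊s⌋₊ : ℝ) - k + 1 := by
      rw [Nat.cast_add, Nat.cast_sub hk.2, Nat.cast_one]
    have hk1 : (1 : ℝ) ≤ k := by exact_mod_cast hk.1
    have hk2 : (k : ℝ) ≤ ⌊s⌋₊ := by exact_mod_cast hk.2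
    have h2 := h0.sub_natCast hS hA hM hw hp (j := ⌊s⌋₊ - k + 1) (by
      rw [hcast]
      linarith [Int.fract_nonneg s])
    rw [hcast, show s - ((⌊s⌋₊ : ℝ) - k + 1) = Int.fract s + k - 1 by linarith] at h2
    have h3 := eqOn_Iic_of_ae_eq hdc
      (isBddCont_fracInt hS hM hw hp (order_of_one_le hp (by linarith)) hf).1
      (hd.ae_unique hS hA hM hw hp h2)
    rw [← hdx, h3 (show t₀ ∈ Iic t₀ from le_refl t₀)]

end Stable

end

end FracParabolic

end

theorem theorem3p5 {X : Type*} [NormedAddCommGroup X] [NormedSpace ℂ X] [CompleteSpace X]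
    (S : ℝ → X →L[ℂ] X) (A : X →ₗ.[ℂ] X)
    (hS : IsMeasurableSemigroup S) (hA : IsNegGenerator S A) (hexp : UniformlyExpStable S)
    (p : ENNReal) (hp : 1 ≤ p) (t₀ s : ℝ)
    (hs : (p = 1 ∧ 1 ≤ s) ∨ (p ≠ 1 ∧ p⁻¹.toReal < s)) :
    -- the identity for `f ∈ L^p(-∞, t₀; X)`, with convergence of all integrals in it
    (∀ f : ℝ → X, MemLp f p (leftLine t₀) →
      (∀ r ≤ t₀, FracIntConvergesAt S s f r) ∧
      (∀ k ∈ Finset.Icc 1 ⌊s⌋₊, FracIntConvergesAt S ((⌊s⌋₊ : ℝ) - k + 1) f t₀) ∧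
      ∀ t : ℝ, t₀ < t →
        FracIntConvergesAt S s ((Iic t₀).indicator f) t ∧
        IntegrableOn (fun τ : ℝ => (τ ^ (-Int.fract s) / (τ + 1)) •
          S ((t - t₀) * (τ + 1)) (fracInt S s f (t₀ - (t - t₀) * τ))) (Ioi 0) ∧
        fracInt S s ((Iic t₀).indicator f) t =
          (Real.sin (Real.pi * Int.fract s) / Real.pi) •
            (∫ τ in Ioi (0 : ℝ), (τ ^ (-Int.fract s) / (τ + 1)) •
              S ((t - t₀) * (τ + 1)) (fracInt S s f (t₀ - (t - t₀) * τ))) +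
          ∑ k ∈ Finset.Icc 1 ⌊s⌋₊,
            ((t - t₀) ^ (Int.fract s + k - 1) / Real.Gamma (Int.fract s + k)) •
              S (t - t₀) (fracInt S ((⌊s⌋₊ : ℝ) - k + 1) f t₀)) ∧
    -- for `g ∈ D(𝔇^s)` with `𝔇^s g = f`: the Dirichlet solution exists and agrees with `v`
    (∀ g f : ℝ → X, HasFracDeriv S A p t₀ s g f →
      (∃ g₀ u : ℝ → X, g₀ =ᵐ[leftLine t₀] g ∧ IsDirichletSolution S A p t₀ s g₀ u) ∧
      ∀ g₀ u : ℝ → X, g₀ =ᵐ[leftLine t₀] g → IsDirichletSolution S A p t₀ s g₀ u →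
        ∀ t : ℝ, t₀ < t → fracInt S s ((Iic t₀).indicator f) t = u t) := by
  obtain ⟨M, w, -, hw, hM⟩ := hexp
  refine ⟨fun f hf => fracInt_extension hS hM hw hp hs hf, fun g f h => ⟨?_, ?_⟩⟩
  · obtain ⟨u, hu⟩ := exists_isDirichletSolution hS hA hM hw hp hs h
    exact ⟨_, u, (h.ae_eq_fracInt hS hA hM hw hp hs).symm, hu⟩
  · intro g₀ u hg₀ hu t ht
    exact hu.fracInt_eq hS hA hM hw hp hs h hg₀ ht
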